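/- **Setting.** Consider an episodic confounded POMDP of horizon $T$ with observed states $S_t\in\mathcal S$, unobserved states $U_t\in\mathcal U$, actions $A_t$ in a finite set $\mathcal A$, rewards $R_t$ with $|R_t|\le 1$, reward proxies $W_t\in\mathcal W$ and action proxies $Z_t\in\mathcal Z$ (all spaces standard Borel), whose law $\Pr$ (expectation $\mathbb E$) is generated by a behaviour policy that may depend on $U_t$. Let $\mathbb P_t$ be the transition kernel, $(S_t,U_t,A_t)\to(S_{t+1},U_{t+1})$. Let $\pi=\{\pi_t(a\mid s)\}_{t=1}^T$ be a target policy, and let $\mathbb E^\pi$ denote expectation when $A_j\sim\pi_j(\cdot\mid S_j)$ and $(R_j,S_{j+1},U_{j+1})$ is drawn from its conditional law given $(S_j,U_j,A_j)$. All conditional expectations are taken with regular conditional distributions, and pointwise statements in conditioning values hold almost everywhere for the law of the conditioning variables under $\Pr$. For each $(s,a)$ write $L^2(W_t\mid s,a)$ and $L^2(Z_t\mid s,a)$ for the $L^2$-spaces of the conditional laws of $W_t$ and $Z_t$ given $S_t=s,A_t=a$, and $$K_{s,a;t}:L^2(W_t\mid s,a)\to L^2(Z_t\mid s,a),\qquad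 h\mapsto \mathbb E[h(W_t)\mid Z_t=\cdot\,,S_t=s,A_t=a].$$ **Assumptions**, for all $1\le t\le T$: 1. *Markov.* Given $(S_t,U_t,A_t)$ and $\{S_j,U_j,A_j\}_{1\le j<t}$, the next state $(S_{t+1},U_{t+1})$ has law $\mathbb P_t(\cdot\mid S_t,U_t,A_t)$. 2. *Reward proxy.* $W_t\perp (A_t,S_{t-1},U_{t-1},A_{t-1})\mid (U_t,S_t)$ (for $t=1$: $W_1\perp A_1\mid (U_1,S_1)$), and $W_t\not\perp U_t\mid S_t$. 3. *Action proxy.* Given $(U_t,S_t,A_t)$, $Z_t$ is independent of $W_t$, of $R_t$, and of $(S_{t+1},W_{t+1})$. 4. *Coverage.* Almost surely, $\Pr(A_t=a\mid S_t,U_t)>0$ for every $a$ with $\pi_t(a\mid S_t)>0$. 5. *Completeness.* For every $(s,a)$ and every $g$ that is square-integrable for the conditional law of its argument given $S_t=s,A_t=a$: (a) $\mathbb E[g(U_t)\mid Z_t,S_t=s,A_t=a]=0$ a.s. iff $g=0$ a.s.; (b) $\mathbb E[g(Z_t)\mid W_t,S_t=s,A_t=a]=0$ a.s. iff $g=0$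 a.s. 6. *Regularity.* There are classes $\mathcal G^{(t)}$, $1\le t\le T+1$, of measurable functions $g$ on $\mathcal W\times\mathcal S$ with $\mathbb E[g(W_t,S_t)^2]<\infty$, such that for every $(s,a)$ and $1\le t\le T$: (a) $W_t$ given $(Z_t,S_t,A_t)$ and $Z_t$ given $(W_t,S_t,A_t)$ have conditional densities (with respect to $\sigma$-finite measures $dw$, $dz$) with $\iint f(w\mid z,s,a)f(z\mid w,s,a)\,dw\,dz<\infty$; (b) for $g\in\mathcal G^{(t+1)}$, the function $b_g(z)=\mathbb E[R_t+g(W_{t+1},S_{t+1})\mid Z_t=z,S_t=s,A_t=a]$ is in $L^2(Z_t\mid s,a)$; (c) $K_{s,a;t}$ has a singular system $(\lambda_\nu,\phi_\nu,\psi_\nu)_\nu$ with $\sum_\nu\lambda_\nu^{-2}|\langle b_g,\psi_\nu\rangle|^2<\infty$ for all $g\in\mathcal G^{(t+1)}$ (the system not depending on $g$); (d) the classes contain the functions produced by the recursion (1) below: $0\in\mathcal G^{(T+1)}$, and if $g\in\mathcal G^{(t+1)}$ and the equation in (1) with $g$ in place of $v_{t+1}$ has a solution $q_t$ with $q_t(\cdot,s,a)\in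 L^2(W_t\mid s,a)$, then it has such a solution for which $\sum_a\pi_t(a\mid s)q_t(w,s,a)$ belongs to $\mathcal G^{(t)}$. **Recursion.** With $v_{T+1}=0$, solve for $t=T,\dots,1$ $$\mathbb E\{q_t(W_t,S_t,A_t)-R_t-v_{t+1}(W_{t+1},S_{t+1})\mid Z_t,S_t,A_t\}=0,\qquad v_t(w,s)=\sum_{a\in\mathcal A}\pi_t(a\mid s)\,q_t(w,s,a), \tag{1}$$ where $q_t$ is measurable with $q_t(\cdot,s,a)\in L^2(W_t\mid s,a)$. **Theorem.** Under these assumptions the recursion (1) has a solution $\{q_t,v_t\}_{t=1}^T$ with $v_t\in\mathcal G^{(t)}$, for which $v_t$ is a V-bridge and $q_t$ is a Q-bridge for all $1\le t\le T$: $$\mathbb E[v_t(W_t,S_t)\mid U_t=u,S_t=s]=\mathbb E^\pi\Big[\sum_{t'=t}^T R_{t'}\,\Big|\,U_t=u,S_t=s\Big],$$ $$\mathbb E[q_t(W_t,S_t,A_t)\mid U_t=u,S_t=s,A_t=a]=\mathbb E^\pi\Big[\sum_{t'=t}^T R_{t'}\,\Big|\,U_t=u,S_t=s,A_t=a\Big].$$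 In particular V-bridges and Q-bridges exist. Moreover, every solution $\{q_t,v_t\}_{t=1}^T$ of (1) with $\mathbb E[v_t(W_t,S_t)^2]<\infty$ for all $t$ consists of V-bridges and Q-bridges. -/

import Mathlib

open MeasureTheory ProbabilityTheory

namespace POMDP

section Trajectories

variable {𝒮 𝒰 𝒜 : Type*} [MeasurableSpace 𝒮] [MeasurableSpace 𝒰] [MeasurableSpace 𝒜]

/-- Target policy at one time, viewed as a kernel from full states `(s, u)`: it ignores `u`. -/
noncomputable def actKernel (p : Kernel 𝒮 𝒜) : Kernel (𝒮 × 𝒰) 𝒜 :=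
  p.comap Prod.fst measurable_fst

/-- Puts `((s, u), a, r)` in front of a trajectory of length `n`. -/
def consStep (n : ℕ)
    (p : ((𝒮 × 𝒰) × 𝒜) × ((ℝ × (𝒮 × 𝒰)) × (Fin n → ((𝒮 × 𝒰) × 𝒜) × ℝ))) :
    Fin (n + 1) → ((𝒮 × 𝒰) × 𝒜) × ℝ :=
  Fin.cons (p.1, p.2.1.1) p.2.2

lemma measurable_consStep (n : ℕ) : Measurable (consStep (𝒮 := 𝒮) (𝒰 := 𝒰) (𝒜 := 𝒜) n) := by
  refine measurable_pi_lambda _ fun i => ?_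
  refine Fin.cases ?_ (fun j => ?_) i
  · simp only [consStep, Fin.cons_zero]; fun_prop
  · simp only [consStep, Fin.cons_succ]; fun_prop

/-- Law of a trajectory that starts at the full state and action `((s, u), a)`: the reward and the
next full state `(r, (s', u'))` are drawn from `step`, and the rest of the trajectory is drawn from
`rest` started at `(s', u')`. -/
noncomputable def firstStep (n : ℕ) (step : Kernel ((𝒮 × 𝒰) × 𝒜) (ℝ × (𝒮 × 𝒰)))
    (rest : Kernel (𝒮 × 𝒰) (Fin n → ((𝒮 × 𝒰) × 𝒜) × ℝ)) :
    Kernel ((𝒮 × 𝒰) × 𝒜) (Fin (n + 1) → ((𝒮 × 𝒰) × 𝒜) × ℝ) :=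
  (Kernel.id ×ₖ (step ⊗ₖ rest.comap (fun p => p.2.2) (by fun_prop))).map (consStep n)

/-- `trajLaw step pol n t (s, u)` is the law of the trajectory
`((S_j, U_j), A_j, R_j)`, `j = t, …, t + n - 1`, started at `(S_t, U_t) = (s, u)`, when the actions
are drawn from the target policy, `A_j ∼ pol j S_j`, and
`(R_j, (S_{j+1}, U_{j+1})) ∼ step j ((S_j, U_j), A_j)`. -/
noncomputable def trajLaw (step : ℕ → Kernel ((𝒮 × 𝒰) × 𝒜) (ℝ × (𝒮 × 𝒰)))
    (pol : ℕ → Kernel 𝒮 𝒜) :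
    (n : ℕ) → (t : ℕ) → Kernel (𝒮 × 𝒰) (Fin n → ((𝒮 × 𝒰) × 𝒜) × ℝ)
  | 0, _ => Kernel.const _ (Measure.dirac Fin.elim0)
  | n + 1, t =>
      firstStep n (step t) (trajLaw step pol n (t + 1)) ∘ₖ (Kernel.id ×ₖ actKernel (pol t))

instance (n : ℕ) (step : Kernel ((𝒮 × 𝒰) × 𝒜) (ℝ × (𝒮 × 𝒰)))
    (rest : Kernel (𝒮 × 𝒰) (Fin n → ((𝒮 × 𝒰) × 𝒜) × ℝ)) [IsMarkovKernel step]
    [IsMarkovKernel rest] : IsMarkovKernel (firstStep n step rest) :=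
  Kernel.IsMarkovKernel.map _ (measurable_consStep n)

instance (p : Kernel 𝒮 𝒜) [IsMarkovKernel p] :
    IsMarkovKernel (actKernel p : Kernel (𝒮 × 𝒰) 𝒜) := by
  unfold actKernel; infer_instance

lemma isMarkovKernel_trajLaw (step : ℕ → Kernel ((𝒮 × 𝒰) × 𝒜) (ℝ × (𝒮 × 𝒰)))
    (pol : ℕ → Kernel 𝒮 𝒜) [∀ t, IsMarkovKernel (step t)] [∀ t, IsMarkovKernel (pol t)] (n t : ℕ) :
    IsMarkovKernel (trajLaw step pol n t) := by
  induction n generalizing t with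
  | zero => unfold trajLaw; infer_instance
  | succ n ih => have := ih (t + 1); unfold trajLaw; infer_instance

/-- `E^π[R_t + … + R_T | S_t = s, U_t = u]`: the expected total reward of the trajectory over
`t, …, T` under the target policy. Meaningful for `t ≤ T + 1`. -/
noncomputable def stateValue (T : ℕ) (step : ℕ → Kernel ((𝒮 × 𝒰) × 𝒜) (ℝ × (𝒮 × 𝒰)))
    (pol : ℕ → Kernel 𝒮 𝒜) (t : ℕ) (x : 𝒮 × 𝒰) : ℝ :=
  ∫ τ, ∑ i, (τ i).2 ∂(trajLaw step pol (T + 1 - t) t x)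

/-- `E^π[R_t + … + R_T | S_t = s, U_t = u, A_t = a]`: as `stateValue`, but the first action is
prescribed. Meaningful for `t ≤ T`. -/
noncomputable def actionValue (T : ℕ) (step : ℕ → Kernel ((𝒮 × 𝒰) × 𝒜) (ℝ × (𝒮 × 𝒰)))
    (pol : ℕ → Kernel 𝒮 𝒜) (t : ℕ) (x : (𝒮 × 𝒰) × 𝒜) : ℝ :=
  ∫ τ, ∑ i, (τ i).2 ∂(firstStep (T - t) (step t) (trajLaw step pol (T - t) (t + 1)) x)

end Trajectories

/-- A confounded POMDP of horizon `T` together with the (behaviour) process that it generates on a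
probability space `(Ω, μ)`: observed states `S`, unobserved states `U`, actions `A`, rewards `R`,
reward proxies `W`, action proxies `Z`, at the times `1, …, T`, and the state and the proxies at
time `T + 1`. (Values at other times are irrelevant.) `step t` is the conditional law of
`(R_t, (S_{t+1}, U_{t+1}))` given `((S_t, U_t), A_t)`; its second marginal is the transition
kernel, and the mean of its first marginal is the reward function. -/
structure ConfoundedPOMDP {Ω : Type*} [MeasurableSpace Ω] (μ : Measure Ω) (T : ℕ)
    (𝒮 𝒰 𝒜 𝒲 𝒵 : Type*) [MeasurableSpace 𝒮] [MeasurableSpace 𝒰] [MeasurableSpace 𝒜]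
    [MeasurableSpace 𝒲] [MeasurableSpace 𝒵] where
  S : ℕ → Ω → 𝒮
  U : ℕ → Ω → 𝒰
  A : ℕ → Ω → 𝒜
  R : ℕ → Ω → ℝ
  W : ℕ → Ω → 𝒲
  Z : ℕ → Ω → 𝒵
  measurable_S : ∀ t, Measurable (S t)
  measurable_U : ∀ t, Measurable (U t)
  measurable_A : ∀ t, Measurable (A t)
  measurable_R : ∀ t, Measurable (R t)
  measurable_W : ∀ t, Measurable (W t)
  measurable_Z : ∀ t, Measurable (Z t)
  step : ℕ → Kernel ((𝒮 × 𝒰) × 𝒜) (ℝ × (𝒮 × 𝒰))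
  step_markov : ∀ t, IsMarkovKernel (step t)
  step_law : ∀ t, 1 ≤ t → t ≤ T →
    HasCondDistrib (fun ω => (R t ω, (S (t + 1) ω, U (t + 1) ω)))
      (fun ω => ((S t ω, U t ω), A t ω)) (step t) μ
  abs_R_le : ∀ t, 1 ≤ t → t ≤ T → ∀ᵐ ω ∂μ, |R t ω| ≤ 1

/-- Let `κ` be a kernel from `𝒵` to `𝒲`, and `κ'` one from `𝒲` to `𝒵`. `(lam ν, φ ν, ψ ν)`, `ν ∈ I`,
is a singular system of the operator `K : L²(m𝒲) → L²(m𝒵)`, `(K h)(z) = ∫ h dκ(z)`, whose adjoint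
is `(K* g)(w) = ∫ g dκ'(w)`: the `lam ν` are positive, the `φ ν` and the `ψ ν` are orthonormal,
`K φ_ν = lam_ν ψ_ν`, `K* ψ_ν = lam_ν φ_ν`, and every `h` orthogonal to all `φ ν` lies in the null
space of `K`. The index set `I` may be finite (operators of finite rank) or infinite. -/
structure IsSingularSystem {𝒲 𝒵 : Type*} [MeasurableSpace 𝒲] [MeasurableSpace 𝒵]
    (m𝒲 : Measure 𝒲) (m𝒵 : Measure 𝒵) (κ : 𝒵 → Measure 𝒲) (κ' : 𝒲 → Measure 𝒵)
    (I : Set ℕ) (lam : ℕ → ℝ) (φ : ℕ → 𝒲 → ℝ) (ψ : ℕ → 𝒵 → ℝ) : Prop where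
  pos : ∀ ν ∈ I, 0 < lam ν
  memLp_φ : ∀ ν ∈ I, MemLp (φ ν) 2 m𝒲
  memLp_ψ : ∀ ν ∈ I, MemLp (ψ ν) 2 m𝒵
  orthonormal_φ : ∀ i ∈ I, ∀ j ∈ I, ∫ w, φ i w * φ j w ∂m𝒲 = if i = j then 1 else 0
  orthonormal_ψ : ∀ i ∈ I, ∀ j ∈ I, ∫ z, ψ i z * ψ j z ∂m𝒵 = if i = j then 1 else 0
  map_φ : ∀ ν ∈ I, ∀ᵐ z ∂m𝒵, ∫ w, φ ν w ∂(κ z) = lam ν * ψ ν z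
  map_ψ : ∀ ν ∈ I, ∀ᵐ w ∂m𝒲, ∫ z, ψ ν z ∂(κ' w) = lam ν * φ ν w
  null : ∀ h : 𝒲 → ℝ, MemLp h 2 m𝒲 → (∀ ν ∈ I, ∫ w, h w * φ ν w ∂m𝒲 = 0) →
    ∀ᵐ z ∂m𝒵, ∫ w, h w ∂(κ z) = 0

namespace ConfoundedPOMDP

variable {Ω : Type*} [MeasurableSpace Ω] {μ : Measure Ω} {T : ℕ}
  {𝒮 𝒰 𝒜 𝒲 𝒵 : Type*} [MeasurableSpace 𝒮] [MeasurableSpace 𝒰] [MeasurableSpace 𝒜]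
  [MeasurableSpace 𝒲] [MeasurableSpace 𝒵]
  (M : ConfoundedPOMDP μ T 𝒮 𝒰 𝒜 𝒲 𝒵)

/-- The full state `(S_t, U_t)`. -/
def su (t : ℕ) (ω : Ω) : 𝒮 × 𝒰 := (M.S t ω, M.U t ω)

/-- `((S_t, U_t), A_t)`. -/
def sua (t : ℕ) (ω : Ω) : (𝒮 × 𝒰) × 𝒜 := (M.su t ω, M.A t ω)

/-- `(S_t, A_t)`. -/
def sa (t : ℕ) (ω : Ω) : 𝒮 × 𝒜 := (M.S t ω, M.A t ω)

/-- `(Z_t, (S_t, A_t))`. -/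
def zsa (t : ℕ) (ω : Ω) : 𝒵 × (𝒮 × 𝒜) := (M.Z t ω, M.sa t ω)

/-- `(W_t, (S_t, A_t))`. -/
def wsa (t : ℕ) (ω : Ω) : 𝒲 × (𝒮 × 𝒜) := (M.W t ω, M.sa t ω)

/-- `(W_t, S_t)`. -/
def ws (t : ℕ) (ω : Ω) : 𝒲 × 𝒮 := (M.W t ω, M.S t ω)

lemma measurable_su (t : ℕ) : Measurable (M.su t) := (M.measurable_S t).prodMk (M.measurable_U t)

lemma measurable_sua (t : ℕ) : Measurable (M.sua t) :=
  (M.measurable_su t).prodMk (M.measurable_A t)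

/-- The history `{S_j, U_j, A_j}`, `1 ≤ j < t`. -/
def history (t : ℕ) (ω : Ω) (j : Finset.Ico 1 t) : (𝒮 × 𝒰) × 𝒜 := M.sua j ω

/-- Markov condition: given the current full state and action and the past, the next full state
follows the transition kernel, which depends on the current full state and action only. -/
def Markovian : Prop :=
  ∀ t, 1 ≤ t → t ≤ T →
    HasCondDistrib (M.su (t + 1)) (fun ω => (M.sua t ω, M.history t ω))
      ((M.step t).snd.prodMkRight (Finset.Ico 1 t → (𝒮 × 𝒰) × 𝒜)) μ

/-- Reward-proxy condition: `W_t` is independent of `A_t` and of the preceding full state and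
action given `(S_t, U_t)`, and `W_t`, `U_t` are dependent given `S_t`. (At `t = 1` there is
no preceding state.) -/
def RewardProxy [StandardBorelSpace Ω] [IsProbabilityMeasure μ] : Prop :=
  (1 ≤ T → M.W 1 ⟂ᵢ[M.su 1, M.measurable_su 1; μ] M.A 1) ∧
  (∀ t, 1 ≤ t → t + 1 ≤ T →
    M.W (t + 1) ⟂ᵢ[M.su (t + 1), M.measurable_su (t + 1); μ]
      (fun ω => (M.A (t + 1) ω, M.sua t ω))) ∧
  (∀ t, 1 ≤ t → t ≤ T → ¬ (M.W t ⟂ᵢ[M.S t, M.measurable_S t; μ] M.U t))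

/-- Action-proxy condition: given `(S_t, U_t, A_t)`, `Z_t` is independent of `W_t`, of `R_t`, and
of `(S_{t+1}, W_{t+1})`. -/
def ActionProxy [StandardBorelSpace Ω] [IsProbabilityMeasure μ] : Prop :=
  ∀ t, 1 ≤ t → t ≤ T →
    (M.Z t ⟂ᵢ[M.sua t, M.measurable_sua t; μ] M.W t) ∧
    (M.Z t ⟂ᵢ[M.sua t, M.measurable_sua t; μ] M.R t) ∧
    (M.Z t ⟂ᵢ[M.sua t, M.measurable_sua t; μ] (M.ws (t + 1)))

/-- Coverage: almost surely, every action that the target policy can take in state `S_t` has a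
positive conditional probability given `(S_t, U_t)` under the behaviour policy. -/
def Coverage [IsProbabilityMeasure μ] [StandardBorelSpace 𝒜] [Nonempty 𝒜] (pol : ℕ → Kernel 𝒮 𝒜) : Prop :=
  ∀ t, 1 ≤ t → t ≤ T → ∀ᵐ x ∂(μ.map (M.su t)), ∀ a : 𝒜,
    0 < pol t x.1 {a} → 0 < condDistrib (M.A t) (M.su t) μ x {a}

/-- Completeness, part (a): for almost every `(s, a)` and every `g ∈ L²` (of the law of `U_t` given
`(S_t, A_t) = (s, a)`), `E[g(U_t) | Z_t, S_t = s, A_t = a] = 0` a.s. iff `g = 0` a.s. -/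
def CompletenessU [IsProbabilityMeasure μ] [StandardBorelSpace 𝒰] [Nonempty 𝒰] [StandardBorelSpace 𝒵] [Nonempty 𝒵] : Prop :=
  ∀ t, 1 ≤ t → t ≤ T → ∀ᵐ x ∂(μ.map (M.sa t)), ∀ g : 𝒰 → ℝ,
    MemLp g 2 (condDistrib (M.U t) (M.sa t) μ x) →
    ((∀ᵐ z ∂(condDistrib (M.Z t) (M.sa t) μ x),
        ∫ u, g u ∂(condDistrib (M.U t) (M.zsa t) μ (z, x)) = 0) ↔
      g =ᵐ[condDistrib (M.U t) (M.sa t) μ x] 0)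

/-- `G t` is a class of measurable functions `g` on `𝒲 × 𝒮` with `g(W_t, S_t) ∈ L²`. -/
def SquareIntegrableClass (G : ℕ → Set (𝒲 × 𝒮 → ℝ)) : Prop :=
  ∀ t, 1 ≤ t → t ≤ T + 1 → ∀ g ∈ G t, Measurable g ∧ MemLp (fun ω => g (M.ws t ω)) 2 μ

variable [IsProbabilityMeasure μ] [StandardBorelSpace 𝒲] [Nonempty 𝒲]

/-- Completeness, part (b): for almost every `(s, a)` and every `g ∈ L²` (of the law of `Z_t` given
`(S_t, A_t) = (s, a)`), `E[g(Z_t) | W_t, S_t = s, A_t = a] = 0` a.s. iff `g = 0` a.s. -/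
def CompletenessZ [StandardBorelSpace 𝒵] [Nonempty 𝒵] : Prop :=
  ∀ t, 1 ≤ t → t ≤ T → ∀ᵐ x ∂(μ.map (M.sa t)), ∀ g : 𝒵 → ℝ,
    MemLp g 2 (condDistrib (M.Z t) (M.sa t) μ x) →
    ((∀ᵐ w ∂(condDistrib (M.W t) (M.sa t) μ x),
        ∫ z, g z ∂(condDistrib (M.Z t) (M.wsa t) μ (w, x)) = 0) ↔
      g =ᵐ[condDistrib (M.Z t) (M.sa t) μ x] 0)

/-- `E[R_t + g(W_{t+1}, S_{t+1}) | Z_t = z, (S_t, A_t) = x]`. -/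
noncomputable def target [StandardBorelSpace 𝒮] [Nonempty 𝒮] (t : ℕ) (g : 𝒲 × 𝒮 → ℝ) (z : 𝒵) (x : 𝒮 × 𝒜) : ℝ :=
  ∫ y, (y.1 + g y.2) ∂(condDistrib (fun ω => (M.R t ω, M.ws (t + 1) ω)) (M.zsa t) μ (z, x))

/-- Existence of conditional densities of `W_t` given `(Z_t, S_t, A_t)` and of `Z_t` given
`(W_t, S_t, A_t)` (with respect to some σ-finite reference measures `dw`, `dz`) with
`∬ f(w | z, s, a) f(z | w, s, a) dw dz < ∞` for almost every `(s, a)`. -/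
def RegularDensities [StandardBorelSpace 𝒵] [Nonempty 𝒵] : Prop :=
  ∀ t, 1 ≤ t → t ≤ T →
    ∃ (dw : Measure 𝒲) (dz : Measure 𝒵) (fW : 𝒵 × (𝒮 × 𝒜) → 𝒲 → ENNReal)
      (fZ : 𝒲 × (𝒮 × 𝒜) → 𝒵 → ENNReal),
      SigmaFinite dw ∧ SigmaFinite dz ∧
      Measurable (Function.uncurry fW) ∧ Measurable (Function.uncurry fZ) ∧
      (∀ᵐ y ∂(μ.map (M.zsa t)), condDistrib (M.W t) (M.zsa t) μ y = dw.withDensity (fW y)) ∧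
      (∀ᵐ y ∂(μ.map (M.wsa t)), condDistrib (M.Z t) (M.wsa t) μ y = dz.withDensity (fZ y)) ∧
      ∀ᵐ x ∂(μ.map (M.sa t)), ∫⁻ w, ∫⁻ z, fW (z, x) w * fZ (w, x) z ∂dz ∂dw < ⊤

/-- For `g` in the class `G (t + 1)`, the function
`z ↦ E[R_t + g(W_{t+1}, S_{t+1}) | Z_t = z, S_t = s, A_t = a]` is square-integrable for the law of
`Z_t` given `(S_t, A_t) = (s, a)`. -/
def RegularTarget [StandardBorelSpace 𝒵] [Nonempty 𝒵] [StandardBorelSpace 𝒮] [Nonempty 𝒮] (G : ℕ → Set (𝒲 × 𝒮 → ℝ)) : Prop :=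
  ∀ t, 1 ≤ t → t ≤ T → ∀ g ∈ G (t + 1), ∀ᵐ x ∂(μ.map (M.sa t)),
    MemLp (fun z => M.target t g z x) 2 (condDistrib (M.Z t) (M.sa t) μ x)

/-- Picard condition: there are singular systems of the operators
`K_{s,a;t} : L²(law of W_t given (s, a)) → L²(law of Z_t given (s, a))`,
`h ↦ E[h(W_t) | Z_t = ·, S_t = s, A_t = a]`, for which the Picard series of
`E[R_t + g(W_{t+1}, S_{t+1}) | Z_t = ·, S_t = s, A_t = a]` converges for all `g ∈ G (t + 1)`. -/
def PicardCondition [StandardBorelSpace 𝒵] [Nonempty 𝒵] [StandardBorelSpace 𝒮] [Nonempty 𝒮] (G : ℕ → Set (𝒲 × 𝒮 → ℝ)) : Prop :=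
  ∀ t, 1 ≤ t → t ≤ T →
    ∃ (I : 𝒮 × 𝒜 → Set ℕ) (lam : 𝒮 × 𝒜 → ℕ → ℝ) (φ : 𝒮 × 𝒜 → ℕ → 𝒲 → ℝ)
      (ψ : 𝒮 × 𝒜 → ℕ → 𝒵 → ℝ),
      (∀ᵐ x ∂(μ.map (M.sa t)),
        IsSingularSystem (condDistrib (M.W t) (M.sa t) μ x) (condDistrib (M.Z t) (M.sa t) μ x)
          (fun z => condDistrib (M.W t) (M.zsa t) μ (z, x))
          (fun w => condDistrib (M.Z t) (M.wsa t) μ (w, x)) (I x) (lam x) (φ x) (ψ x)) ∧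
      ∀ g ∈ G (t + 1), ∀ᵐ x ∂(μ.map (M.sa t)),
        Summable fun ν : I x => (lam x ν)⁻¹ ^ 2 *
          (∫ z, M.target t g z x * ψ x ν z ∂(condDistrib (M.Z t) (M.sa t) μ x)) ^ 2

/-- `q` solves the linear integral equation
`E[q(W_t, S_t, A_t) - R_t - g(W_{t+1}, S_{t+1}) | Z_t, S_t, A_t] = 0` a.s.; for almost every
`(s, a)`, `q(·, s, a)` belongs to the domain `L²(law of W_t given (S_t, A_t) = (s, a))` of the
operator `K_{s,a;t}`. -/
def SolvesEquation [StandardBorelSpace 𝒮] [Nonempty 𝒮] (t : ℕ) (q : 𝒲 × 𝒮 × 𝒜 → ℝ) (g : 𝒲 × 𝒮 → ℝ) : Prop :=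
  Measurable q ∧
  (∀ᵐ x ∂(μ.map (M.sa t)),
    MemLp (fun w => q (w, x.1, x.2)) 2 (condDistrib (M.W t) (M.sa t) μ x)) ∧
  ∀ᵐ y ∂(μ.map (M.zsa t)),
    Integrable (fun p : 𝒲 × ℝ × (𝒲 × 𝒮) => q (p.1, y.2.1, y.2.2) - p.2.1 - g p.2.2)
      (condDistrib (fun ω => (M.W t ω, M.R t ω, M.ws (t + 1) ω)) (M.zsa t) μ y) ∧
    ∫ p, (q (p.1, y.2.1, y.2.2) - p.2.1 - g p.2.2)
      ∂(condDistrib (fun ω => (M.W t ω, M.R t ω, M.ws (t + 1) ω)) (M.zsa t) μ y) = 0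

/-- `∑_a π(a | s) q(w, s, a)`. -/
noncomputable def policyAverage [Fintype 𝒜] (p : Kernel 𝒮 𝒜) (q : 𝒲 × 𝒮 × 𝒜 → ℝ) : 𝒲 × 𝒮 → ℝ :=
  fun x => ∑ a, (p x.2).real {a} * q (x.1, x.2, a)

/-- The classes `G t` contain the functions produced by the backward recursion: `0 ∈ G (T + 1)`,
and whenever the integral equation at time `t` with `g ∈ G (t + 1)` in place of `v_{t+1}` is
solvable, it has a solution `q` for which `∑_a π_t(a | s) q(w, s, a)` belongs to `G t`. Solvability
itself is not asserted. -/
def ContainsBridges [StandardBorelSpace 𝒮] [Nonempty 𝒮] [Fintype 𝒜] (pol : ℕ → Kernel 𝒮 𝒜)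
    (G : ℕ → Set (𝒲 × 𝒮 → ℝ)) : Prop :=
  0 ∈ G (T + 1) ∧
  ∀ t, 1 ≤ t → t ≤ T → ∀ g ∈ G (t + 1),
    (∃ q, M.SolvesEquation t q g) →
      ∃ q, M.SolvesEquation t q g ∧ policyAverage (pol t) q ∈ G t

/-- `q_T, v_T, …, q_1, v_1` are obtained by solving the integral equations recursively, starting
from `v_{T+1} = 0`, with `v_t(w, s) = ∑_a π_t(a | s) q_t(w, s, a)`. -/
def SolvesRecursion [StandardBorelSpace 𝒮] [Nonempty 𝒮] [Fintype 𝒜] (pol : ℕ → Kernel 𝒮 𝒜)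
    (q : ℕ → 𝒲 × 𝒮 × 𝒜 → ℝ) (v : ℕ → 𝒲 × 𝒮 → ℝ) : Prop :=
  v (T + 1) = 0 ∧
  ∀ t, 1 ≤ t → t ≤ T →
    M.SolvesEquation t (q t) (v (t + 1)) ∧ v t = policyAverage (pol t) (q t)

/-- `v` is a V-bridge at time `t`: for almost every `(s, u)`,
`E[v(W_t, S_t) | S_t = s, U_t = u] = E^π[R_t + … + R_T | S_t = s, U_t = u]`. -/
def IsVBridge (pol : ℕ → Kernel 𝒮 𝒜) (t : ℕ) (v : 𝒲 × 𝒮 → ℝ) : Prop :=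
  Measurable v ∧
  ∀ᵐ x ∂(μ.map (M.su t)),
    Integrable (fun w => v (w, x.1)) (condDistrib (M.W t) (M.su t) μ x) ∧
    ∫ w, v (w, x.1) ∂(condDistrib (M.W t) (M.su t) μ x) = stateValue T M.step pol t x

/-- `q` is a Q-bridge at time `t`: for almost every `(s, u, a)`,
`E[q(W_t, S_t, A_t) | S_t = s, U_t = u, A_t = a] = E^π[R_t + … + R_T | S_t = s, U_t = u, A_t = a]`. -/
def IsQBridge (pol : ℕ → Kernel 𝒮 𝒜) (t : ℕ) (q : 𝒲 × 𝒮 × 𝒜 → ℝ) : Prop :=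
  Measurable q ∧
  ∀ᵐ x ∂(μ.map (M.sua t)),
    Integrable (fun w => q (w, x.1.1, x.2)) (condDistrib (M.W t) (M.sua t) μ x) ∧
    ∫ w, q (w, x.1.1, x.2) ∂(condDistrib (M.W t) (M.sua t) μ x) = actionValue T M.step pol t x

end ConfoundedPOMDP
end POMDP

/-!
Both halves of the theorem concern the operators
`K h = E[h(W_t) | Z_t = ·, S_t = s, A_t = a]` between the `L²` spaces of the conditional laws of
`W_t` and `Z_t`.

*Solvability.* For fixed `(s, a)` the completeness condition in `Z_t` says that the adjoint of `K`
is injective, so the `ψ ν` of a singular system form a complete orthonormal system and the Picard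
condition yields a solution (`POMDP.IsSingularSystem.exists_memLp_integral_eq`). The singular
systems are not assumed to depend measurably on `(s, a)`, hence neither do these solutions. They only serve
to show that the Landweber iterates `h ↦ h + K'(b - K h)` converge to a solution
(`exists_tendsto_landweber`): the iterates are built from kernel integrals and are jointly
measurable, and so is a suitable version of their limit (`exists_measurable_solution`).

*Bridges.* Let `q` solve the integral equation at time `t`, with a V-bridge `v` at time `t + 1`. As
`Z_t` is independent of `W_t`, of `R_t` and of `(S_{t+1}, W_{t+1})` given `(S_t, U_t, A_t)`, the
expectation of `q - R_t - v` given `(S_t, U_t, A_t)` has conditional expectation zero given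
`(Z_t, S_t, A_t)`, and vanishes by completeness in `U_t`
(`POMDP.ConfoundedPOMDP.SolvesEquation.ae_integral_eq`). The reward-proxy condition turns the
expectation of `v` into the expected value of the next full state
(`POMDP.ConfoundedPOMDP.ae_integral_ws_eq_of_isVBridge`), so that the Bellman equation identifies
`q` as a Q-bridge. The policy average of `q` is a V-bridge, since `W_t` is independent of `A_t`
given `(S_t, U_t)` and by coverage (`POMDP.ConfoundedPOMDP.isVBridge_policyAverage`).

Values are expectations under the target policy, whereas the bound on the rewards and all almost
sure statements refer to the behaviour policy; `POMDP.ConfoundedPOMDP.ae_abs_reward_le` carries the bound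
over.
-/

open Filter Topology ENNReal

/-! ### Operator equations in Hilbert spaces -/

/-- **Picard's criterion.** Let `φ`, `ψ` be a singular system of `K`, whose adjoint `K'` is
injective. If the Picard series of `b` converges, then `K h = b` for
`h = ∑ᵢ λᵢ⁻¹ ⟪b, ψᵢ⟫ φᵢ`. -/
lemma exists_apply_eq_of_summable_picard {H₁ H₂ : Type*}
    [NormedAddCommGroup H₁] [InnerProductSpace ℝ H₁] [CompleteSpace H₁]
    [NormedAddCommGroup H₂] [InnerProductSpace ℝ H₂]
    (K : H₁ →L[ℝ] H₂) (K' : H₂ →L[ℝ] H₁) (hadj : ∀ h g, inner ℝ (K h) g = inner ℝ h (K' g))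
    (hinj : ∀ g, K' g = 0 → g = 0)
    {ι : Type*} (lam : ι → ℝ) (φ : ι → H₁) (ψ : ι → H₂) (hlam : ∀ i, 0 < lam i)
    (hφ : Orthonormal ℝ φ) (hψ : Orthonormal ℝ ψ) (hK : ∀ i, K (φ i) = lam i • ψ i)
    (hnull : ∀ h, (∀ i, inner ℝ h (φ i) = 0) → K h = 0)
    (b : H₂) (hsum : Summable fun i => (lam i)⁻¹ ^ 2 * (inner ℝ b (ψ i)) ^ 2) :
    ∃ h, K h = b := by
  set c : ι → ℝ := fun i => (lam i)⁻¹ * inner ℝ b (ψ i) with hc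
  have hS : Summable fun i => c i • φ i := by
    have := (hφ.orthogonalFamily (𝕜 := ℝ)).summable_iff_norm_sq_summable c
    simp only [LinearIsometry.toSpanSingleton_apply] at this
    rw [this]
    simpa [hc, mul_pow] using hsum
  obtain ⟨h, hh⟩ := hS
  refine ⟨h, ?_⟩
  have hKh : HasSum (fun i => (inner ℝ b (ψ i) : ℝ) • ψ i) (K h) := by
    convert hh.mapL K using 2 with i
    rw [map_smul, hK, smul_smul, hc]
    congr 1
    have := (hlam i).ne'
    field_simp
  -- The residual `b - K h` is orthogonal to all `ψ i`, hence in the null space of `K'`.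
  have hin : ∀ i, inner ℝ (b - K h) (ψ i) = 0 := by
    intro i
    have h1 : HasSum (fun j => (inner ℝ (ψ i) ((inner ℝ b (ψ j) : ℝ) • ψ j) : ℝ))
        (inner ℝ (ψ i) (K h)) := hKh.mapL (innerSL ℝ (ψ i))
    have h2 : HasSum (fun j => (inner ℝ (ψ i) ((inner ℝ b (ψ j) : ℝ) • ψ j) : ℝ))
        (inner ℝ b (ψ i)) := by
      classical
      convert hasSum_ite_eq i (inner ℝ b (ψ i) : ℝ) using 2 with j
      rw [inner_smul_right, orthonormal_iff_ite.mp hψ i j]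
      rcases eq_or_ne j i with rfl | hij
      · simp
      · simp [hij, hij.symm]
    rw [inner_sub_left, real_inner_comm (ψ i) (K h), h1.unique h2, sub_self]
  have h3 : K (K' (b - K h)) = 0 := by
    refine hnull _ fun i => ?_
    rw [real_inner_comm, ← hadj, hK, inner_smul_left, real_inner_comm, hin]; simp
  have h4 : K' (b - K h) = 0 := by
    rw [← inner_self_eq_zero (𝕜 := ℝ), ← hadj, h3, inner_zero_left]
  exact (sub_eq_zero.mp (hinj _ h4)).symm

/-- **Landweber iteration.** If `K h = b` is solvable and `K'` is the adjoint of `K`, with norm at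
most one, then the iterates `h ↦ h + K' (b - K h)` converge to a solution. -/
lemma exists_tendsto_landweber {H₁ H₂ : Type*}
    [NormedAddCommGroup H₁] [InnerProductSpace ℝ H₁] [CompleteSpace H₁]
    [NormedAddCommGroup H₂] [InnerProductSpace ℝ H₂]
    (K : H₁ →L[ℝ] H₂) (K' : H₂ →L[ℝ] H₁) (hadj : ∀ h g, inner ℝ (K h) g = inner ℝ h (K' g))
    (hK' : ∀ g, ‖K' g‖ ≤ ‖g‖) (b : H₂) (h₀ : H₁) (hb : K h₀ = b)
    (h : ℕ → H₁) (hsucc : ∀ n, h (n + 1) = h n + K' (b - K (h n))) :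
    ∃ l, Tendsto h atTop (𝓝 l) ∧ K l = b := by
  -- The error `d n` after `n` steps is `A ^ n (d 0)`, where `A = 1 - K' K` satisfies
  -- `0 ≤ A ^ 2 ≤ A ≤ 1`; so `a n = ⟪A ^ n (d 0), d 0⟫` is decreasing and nonnegative.
  obtain ⟨d, hd⟩ : ∃ d : ℕ → H₁, ∀ n, d n = h₀ - h n := ⟨_, fun _ => rfl⟩
  have hdS : ∀ n, d (n + 1) = d n - K' (K (d n)) := by
    intro n
    simp only [hd, hsucc, ← hb, map_sub]; abel
  have hsymm : ∀ x y : H₁, inner ℝ (K' (K x)) y = inner ℝ x (K' (K y)) := by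
    intro x y
    rw [← hadj, real_inner_comm, ← hadj, real_inner_comm]
  have hshift : ∀ n m, inner ℝ (d (n + 1)) (d m) = inner ℝ (d n) (d (m + 1)) := by
    intro n m
    rw [hdS, hdS, inner_sub_left, inner_sub_right, hsymm]
  set a : ℕ → ℝ := fun n => inner ℝ (d n) (d 0) with ha
  have hinner : ∀ m n, inner ℝ (d n) (d m) = a (n + m) := by
    intro m
    induction m with
    | zero => intro n; rfl
    | succ m ih => intro n; rw [← hshift, ih]; congr 1; omega
  have hstep : ∀ n, a (n + n) - a (n + n + 1) = ‖K (d n)‖ ^ 2 := by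
    intro n
    have h1 : a (n + n + 1) = inner ℝ (d n) (d (n + 1)) := by rw [hinner]; rfl
    rw [h1, ← hinner, hdS, inner_sub_right, ← hadj, real_inner_self_eq_norm_sq (K (d n))]; ring
  have hstep' : ∀ n, a (n + n + 2) ≤ a (n + n + 1) := by
    intro n
    have h1 : a (n + n + 2) = inner ℝ (d (n + 1)) (d (n + 1)) := by rw [hinner]; congr 1; omega
    have h2 : a (n + n + 1) = inner ℝ (d (n + 1)) (d n) := by rw [hinner]; congr 1; omega
    have h3 : inner ℝ (d (n + 1)) (K' (K (d n))) = ‖K (d n)‖ ^ 2 - ‖K' (K (d n))‖ ^ 2 := by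
      rw [hdS, inner_sub_left, ← hadj, real_inner_self_eq_norm_sq,
        real_inner_self_eq_norm_sq]
    have h4 : ‖K' (K (d n))‖ ^ 2 ≤ ‖K (d n)‖ ^ 2 := by
      gcongr; exact hK' _
    rw [h1, h2]
    nth_rewrite 2 [hdS]
    rw [inner_sub_right, h3]; linarith
  have hanti : Antitone a := by
    refine antitone_nat_of_succ_le fun n => ?_
    obtain ⟨k, rfl | rfl⟩ := Nat.even_or_odd' n
    · have := hstep k
      rw [two_mul]; nlinarith [sq_nonneg ‖K (d k)‖]
    · have := hstep' k
      rw [two_mul]; exact this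
  have hbdd : BddBelow (Set.range a) := by
    refine ⟨0, ?_⟩
    rintro _ ⟨n, rfl⟩
    have h1 : 0 ≤ a (n + n) := by rw [← hinner]; exact real_inner_self_nonneg
    exact h1.trans (hanti (by omega))
  -- `‖h n - h m‖ ^ 2 = a (2 n) - 2 a (n + m) + a (2 m)` tends to zero since `a` converges.
  have hlim := tendsto_atTop_ciInf hanti hbdd
  set L := ⨅ i, a i
  have hcauchy : CauchySeq h := by
    rw [Metric.cauchySeq_iff']
    intro ε hε
    have hev : ∀ᶠ n in atTop, a n < L + ε ^ 2 / 2 :=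
      hlim.eventually_lt_const (by have : 0 < ε ^ 2 / 2 := by positivity
                                   linarith)
    obtain ⟨N, hN⟩ := eventually_atTop.mp hev
    refine ⟨N, fun n hn => ?_⟩
    have hLle : ∀ n, L ≤ a n := fun n => ciInf_le hbdd n
    have h1 : ‖h n - h N‖ ^ 2 = a (n + n) - 2 * a (n + N) + a (N + N) := by
      have : h n - h N = d N - d n := by simp [hd]
      rw [this, norm_sub_sq_real, ← real_inner_self_eq_norm_sq, ← real_inner_self_eq_norm_sq,
        hinner, hinner, hinner, add_comm N n]; ring
    have h2 : ‖h n - h N‖ ^ 2 < ε ^ 2 := by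
      rw [h1]
      have := hN (n + n) (by omega)
      have := hN (N + N) (by omega)
      have := hLle (n + N)
      linarith
    rw [dist_eq_norm]
    exact lt_of_pow_lt_pow_left₀ 2 hε.le h2
  obtain ⟨l, hl⟩ := cauchySeq_tendsto_of_complete hcauchy
  refine ⟨l, hl, ?_⟩
  have hK0 : Tendsto (fun n => ‖K (d n)‖ ^ 2) atTop (𝓝 0) := by
    have h1 : Tendsto (fun n : ℕ => n + n) atTop atTop :=
      tendsto_atTop_mono (fun n => Nat.le_add_left n n) tendsto_id
    have h2 := (hlim.comp h1).sub ((hlim.comp (tendsto_add_atTop_nat 1)).comp h1)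
    rw [sub_self] at h2
    exact h2.congr fun n => hstep n
  have hK1 : Tendsto (fun n => ‖K (d n)‖ ^ 2) atTop (𝓝 (‖K (h₀ - l)‖ ^ 2)) := by
    have h1 : Tendsto (fun n => K (d n)) atTop (𝓝 (K (h₀ - l))) :=
      (K.continuous.tendsto _).comp ((tendsto_const_nhds.sub hl).congr fun n => (hd n).symm)
    exact (h1.norm).pow 2
  have h5 := tendsto_nhds_unique hK1 hK0
  have h6 : K (h₀ - l) = 0 := by simpa using h5
  rw [map_sub, sub_eq_zero] at h6
  rw [← h6, hb]

/-! ### Operators of conditional expectation on `L²` -/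

/-- Jensen's inequality: averaging over a Markov kernel is a contraction of `L²`. -/
lemma memLp_integral_kernel {α β : Type*} [MeasurableSpace α] [MeasurableSpace β]
    {m : Measure α} [IsProbabilityMeasure m] {κ : Kernel α β} [IsMarkovKernel κ]
    {h : β → ℝ} (hh : MemLp h 2 (κ ∘ₘ m)) :
    MemLp (fun a => ∫ b, h b ∂(κ a)) 2 m ∧
      eLpNorm (fun a => ∫ b, h b ∂(κ a)) 2 m ≤ eLpNorm h 2 (κ ∘ₘ m) := by
  have hmeas : AEStronglyMeasurable (fun a => ∫ b, h b ∂(κ a)) m := by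
    have h1 : AEStronglyMeasurable (fun p : α × β => h p.2) (m ⊗ₘ κ) := by
      have h2 : (m ⊗ₘ κ).snd = κ ∘ₘ m := Measure.snd_compProd m κ
      have h3 := hh.1
      rw [← h2] at h3
      exact h3.comp_measurable measurable_snd
    exact AEStronglyMeasurable.integral_kernel_compProd (κ := Kernel.const Unit m) (a := ())
      (η := Kernel.prodMkLeft Unit κ) (f := fun p : α × β => h p.2) h1
  have hle : eLpNorm (fun a => ∫ b, h b ∂(κ a)) 2 m ≤ eLpNorm h 2 (κ ∘ₘ m) := by
    have haes : ∀ᵐ a ∂m, AEStronglyMeasurable h (κ a) := by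
      obtain ⟨g, hg, hgh⟩ := hh.1
      filter_upwards [Measure.ae_ae_of_ae_comp hgh] with a ha
      exact ⟨g, hg, ha⟩
    rw [eLpNorm_eq_lintegral_rpow_enorm_toReal (by norm_num) (by norm_num),
      eLpNorm_eq_lintegral_rpow_enorm_toReal (by norm_num) (by norm_num)]
    gcongr ?_ ^ _
    obtain ⟨g, hg, hgh⟩ := hh.1
    have hint : ∫⁻ b, ‖h b‖ₑ ^ (2 : ℝ≥0∞).toReal ∂(κ ∘ₘ m)
        = ∫⁻ a, ∫⁻ b, ‖h b‖ₑ ^ (2 : ℝ≥0∞).toReal ∂(κ a) ∂m := by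
      refine Measure.lintegral_bind κ.measurable.aemeasurable ?_
      exact hh.1.enorm.pow_const _
    rw [hint]
    refine lintegral_mono_ae ?_
    filter_upwards [haes] with a ha
    have h1 : ‖∫ b, h b ∂(κ a)‖ₑ ≤ eLpNorm h 2 (κ a) := by
      refine (enorm_integral_le_lintegral_enorm _).trans ?_
      rw [← eLpNorm_one_eq_lintegral_enorm]
      exact eLpNorm_le_eLpNorm_of_exponent_le (by norm_num) ha
    calc ‖∫ b, h b ∂(κ a)‖ₑ ^ (2 : ℝ≥0∞).toReal
        ≤ (eLpNorm h 2 (κ a)) ^ (2 : ℝ≥0∞).toReal := by gcongr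
      _ = _ := by
        rw [eLpNorm_eq_lintegral_rpow_enorm_toReal (by norm_num) (by norm_num), ← ENNReal.rpow_mul]
        simp
  exact ⟨⟨hmeas, hle.trans_lt hh.2⟩, hle⟩

/-- Averaging over a Markov kernel, as a continuous linear operator on `L²`. -/
lemma exists_kernelOperator {α β : Type*} [MeasurableSpace α] [MeasurableSpace β]
    (m : Measure α) [IsProbabilityMeasure m] (κ : Kernel α β) [IsMarkovKernel κ]
    (m' : Measure β) (hm : κ ∘ₘ m = m') :
    ∃ K : Lp ℝ 2 m' →L[ℝ] Lp ℝ 2 m, (∀ h, ‖K h‖ ≤ ‖h‖) ∧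
      ∀ (h : β → ℝ) (hh : MemLp h 2 m'), K (hh.toLp h) =ᵐ[m] fun a => ∫ b, h b ∂(κ a) := by
  subst hm
  have hmem : ∀ h : Lp ℝ 2 (κ ∘ₘ m), MemLp (fun a => ∫ b, h b ∂(κ a)) 2 m := fun h =>
    (memLp_integral_kernel (Lp.memLp h)).1
  have hcongr : ∀ {f g : β → ℝ}, f =ᵐ[κ ∘ₘ m] g →
      (fun a => ∫ b, f b ∂(κ a)) =ᵐ[m] fun a => ∫ b, g b ∂(κ a) := by
    intro f g hfg
    filter_upwards [Measure.ae_ae_of_ae_comp hfg] with a ha using integral_congr_ae ha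
  have hintble : ∀ h : Lp ℝ 2 (κ ∘ₘ m), ∀ᵐ a ∂m, Integrable h (κ a) := by
    intro h
    exact Measure.ae_integrable_of_integrable_comp ((Lp.memLp h).integrable (by norm_num))
  let K₀ : Lp ℝ 2 (κ ∘ₘ m) →ₗ[ℝ] Lp ℝ 2 m :=
    { toFun := fun h => (hmem h).toLp _
      map_add' := by
        intro f g
        rw [← MemLp.toLp_add, MemLp.toLp_eq_toLp_iff]
        filter_upwards [hcongr (Lp.coeFn_add f g), hintble f, hintble g] with a h1 h2 h3
        rw [h1, Pi.add_apply, ← integral_add h2 h3]; rfl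
      map_smul' := by
        intro c f
        rw [RingHom.id_apply, ← MemLp.toLp_const_smul, MemLp.toLp_eq_toLp_iff]
        filter_upwards [hcongr (Lp.coeFn_smul c f)] with a h1
        rw [h1, Pi.smul_apply, ← integral_smul]; rfl }
  have hbound : ∀ h, ‖K₀ h‖ ≤ 1 * ‖h‖ := by
    intro h
    rw [one_mul, Lp.norm_def, Lp.norm_def]
    refine ENNReal.toReal_mono (Lp.eLpNorm_ne_top h) ?_
    refine (le_of_eq (eLpNorm_congr_ae ((hmem h).coeFn_toLp))).trans ?_
    exact (memLp_integral_kernel (Lp.memLp h)).2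
  refine ⟨K₀.mkContinuous 1 hbound, fun h => by simpa using hbound h, fun h hh => ?_⟩
  refine ((hmem _).coeFn_toLp).trans ?_
  exact hcongr hh.coeFn_toLp

/-- If `(m, κ)` and `(m', κ')` are the two disintegrations of one joint law, then averaging over `κ`
and averaging over `κ'` are adjoint to each other. -/
lemma integral_integral_kernel_mul_eq {α β : Type*} [MeasurableSpace α] [MeasurableSpace β]
    {m : Measure α} [IsProbabilityMeasure m] {κ : Kernel α β} [IsMarkovKernel κ]
    {m' : Measure β} [IsProbabilityMeasure m'] {κ' : Kernel β α} [IsMarkovKernel κ']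
    (hjoint : (m ⊗ₘ κ).map Prod.swap = m' ⊗ₘ κ') {h : β → ℝ} {g : α → ℝ}
    (hh : MemLp h 2 m') (hg : MemLp g 2 m) :
    ∫ a, (∫ b, h b ∂(κ a)) * g a ∂m = ∫ b, h b * ∫ a, g a ∂(κ' b) ∂m' := by
  have hm' : (m ⊗ₘ κ).snd = m' := by
    rw [← Measure.fst_map_swap, hjoint, Measure.fst_compProd]
  have hm : (m ⊗ₘ κ).fst = m := Measure.fst_compProd m κ
  have h1 : MemLp (fun p : α × β => h p.2) 2 (m ⊗ₘ κ) :=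
    MemLp.comp_measurePreserving hh ⟨measurable_snd, hm'⟩
  have h2 : MemLp (fun p : α × β => g p.1) 2 (m ⊗ₘ κ) :=
    MemLp.comp_measurePreserving hg ⟨measurable_fst, hm⟩
  have h3 : Integrable (fun p : α × β => h p.2 * g p.1) (m ⊗ₘ κ) := h1.integrable_mul h2
  have h4 : Integrable (fun p : β × α => h p.1 * g p.2) (m' ⊗ₘ κ') := by
    rw [← hjoint]
    exact (MeasurableEquiv.prodComm.measurableEmbedding.integrable_map_iff
      (g := fun p : β × α => h p.1 * g p.2)).mpr h3
  have h5 : ∫ p, h p.1 * g p.2 ∂(m' ⊗ₘ κ') = ∫ p, h p.2 * g p.1 ∂(m ⊗ₘ κ) := by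
    rw [← hjoint]
    exact MeasurableEquiv.prodComm.measurableEmbedding.integral_map
      (fun p : β × α => h p.1 * g p.2)
  rw [Measure.integral_compProd h3, Measure.integral_compProd h4] at h5
  simp_rw [integral_mul_const, integral_const_mul] at h5
  exact h5.symm

/-- The two disintegrations of a joint law give a contraction `K` of `L²` spaces and its
adjoint `K'`, both acting on functions as averaging over a kernel. -/
lemma exists_adjoint_kernelOperators {α β : Type*} [MeasurableSpace α] [MeasurableSpace β]
    {m : Measure α} [IsProbabilityMeasure m] {κ : Kernel α β} [IsMarkovKernel κ]
    {m' : Measure β} [IsProbabilityMeasure m'] {κ' : Kernel β α} [IsMarkovKernel κ']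
    (hjoint : (m ⊗ₘ κ).map Prod.swap = m' ⊗ₘ κ') :
    ∃ (K : Lp ℝ 2 m' →L[ℝ] Lp ℝ 2 m) (K' : Lp ℝ 2 m →L[ℝ] Lp ℝ 2 m'),
      (∀ (h : β → ℝ) (hh : MemLp h 2 m'), K (hh.toLp h) =ᵐ[m] fun a => ∫ b, h b ∂(κ a)) ∧
      (∀ (g : α → ℝ) (hg : MemLp g 2 m), K' (hg.toLp g) =ᵐ[m'] fun b => ∫ a, g a ∂(κ' b)) ∧
      (∀ h g, inner ℝ (K h) g = inner ℝ h (K' g)) ∧ ∀ g, ‖K' g‖ ≤ ‖g‖ := by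
  have hm' : κ ∘ₘ m = m' := by
    rw [← Measure.snd_compProd, ← Measure.fst_map_swap, hjoint, Measure.fst_compProd]
  have hm : κ' ∘ₘ m' = m := by
    rw [← Measure.snd_compProd, ← hjoint, Measure.snd_map_swap, Measure.fst_compProd]
  obtain ⟨K, -, hK⟩ := exists_kernelOperator m κ m' hm'
  obtain ⟨K', hK'le, hK'⟩ := exists_kernelOperator m' κ' m hm
  refine ⟨K, K', hK, hK', fun h g => ?_, hK'le⟩
  rw [L2.inner_def, L2.inner_def]
  have h1 := integral_integral_kernel_mul_eq hjoint (Lp.memLp h) (Lp.memLp g)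
  have h2 : K h =ᵐ[m] fun a => ∫ b, h b ∂(κ a) := by
    conv_lhs => rw [← Lp.toLp_coeFn h (Lp.memLp h)]
    exact hK _ _
  have h3 : K' g =ᵐ[m'] fun b => ∫ a, g a ∂(κ' b) := by
    conv_lhs => rw [← Lp.toLp_coeFn g (Lp.memLp g)]
    exact hK' _ _
  calc ∫ a, inner ℝ (K h a) (g a) ∂m = ∫ a, (∫ b, h b ∂(κ a)) * g a ∂m := by
        refine integral_congr_ae ?_
        filter_upwards [h2] with a ha
        rw [ha]; simp [mul_comm]
    _ = _ := by
        rw [h1]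
        refine integral_congr_ae ?_
        filter_upwards [h3] with a ha
        rw [ha]; simp [mul_comm]

lemma inner_toLp_eq_integral_mul {α : Type*} [MeasurableSpace α] {m : Measure α} {f g : α → ℝ}
    (hf : MemLp f 2 m) (hg : MemLp g 2 m) :
    inner ℝ (hf.toLp f) (hg.toLp g) = ∫ x, f x * g x ∂m := by
  rw [L2.inner_def]
  refine integral_congr_ae ?_
  filter_upwards [hf.coeFn_toLp, hg.coeFn_toLp] with x h1 h2
  rw [h1, h2]; simp [mul_comm]

/-- Picard's criterion for the operator `h ↦ ∫ h dκ` of conditional expectation. -/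
lemma POMDP.IsSingularSystem.exists_memLp_integral_eq {𝒲 𝒵 : Type*}
    [MeasurableSpace 𝒲] [MeasurableSpace 𝒵]
    {m𝒲 : Measure 𝒲} [IsProbabilityMeasure m𝒲] {m𝒵 : Measure 𝒵} [IsProbabilityMeasure m𝒵]
    {κ : Kernel 𝒵 𝒲} [IsMarkovKernel κ] {κ' : Kernel 𝒲 𝒵} [IsMarkovKernel κ']
    (hjoint : (m𝒵 ⊗ₘ κ).map Prod.swap = m𝒲 ⊗ₘ κ')
    {I : Set ℕ} {lam : ℕ → ℝ} {φ : ℕ → 𝒲 → ℝ} {ψ : ℕ → 𝒵 → ℝ}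
    (hS : POMDP.IsSingularSystem m𝒲 m𝒵 κ κ' I lam φ ψ)
    (hinj : ∀ g : 𝒵 → ℝ, MemLp g 2 m𝒵 → (∀ᵐ w ∂m𝒲, ∫ z, g z ∂(κ' w) = 0) → g =ᵐ[m𝒵] 0)
    {b : 𝒵 → ℝ} (hb : MemLp b 2 m𝒵)
    (hsum : Summable fun ν : I => (lam ν)⁻¹ ^ 2 * (∫ z, b z * ψ ν z ∂m𝒵) ^ 2) :
    ∃ h : 𝒲 → ℝ, MemLp h 2 m𝒲 ∧ ∀ᵐ z ∂m𝒵, ∫ w, h w ∂(κ z) = b z := by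
  obtain ⟨K, K', hK, hK', hadj, -⟩ := exists_adjoint_kernelOperators hjoint
  have hex : ∃ h, K h = hb.toLp b := by
    refine exists_apply_eq_of_summable_picard K K' hadj ?_ (fun i : I => lam i)
      (fun i : I => (hS.memLp_φ i i.2).toLp) (fun i : I => (hS.memLp_ψ i i.2).toLp)
      (fun i => hS.pos i i.2) ?_ ?_ ?_ ?_ (hb.toLp b) ?_
    · intro g hg
      have h1 := hK' g (Lp.memLp g)
      rw [Lp.toLp_coeFn, hg] at h1
      have h2 := hinj g (Lp.memLp g) (by
        filter_upwards [h1, Lp.coeFn_zero ℝ 2 m𝒲] with w h2 h3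
        rw [← h2, h3]; rfl)
      exact (Lp.eq_zero_iff_ae_eq_zero).mpr h2
    · classical
      rw [orthonormal_iff_ite]
      intro i j
      rw [inner_toLp_eq_integral_mul, hS.orthonormal_φ i i.2 j j.2]
      simp [Subtype.ext_iff]
    · classical
      rw [orthonormal_iff_ite]
      intro i j
      rw [inner_toLp_eq_integral_mul, hS.orthonormal_ψ i i.2 j j.2]
      simp [Subtype.ext_iff]
    · intro i
      rw [← MemLp.toLp_const_smul]
      refine Lp.ext ?_
      refine (hK _ _).trans ?_
      filter_upwards [hS.map_φ i i.2, MemLp.coeFn_toLp ((hS.memLp_ψ i i.2).const_smul (lam i))]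
        with z h1 h2
      rw [h1, h2]; rfl
    · intro h hh
      have h1 := hS.null h (Lp.memLp h) (fun ν hν => by
        have := hh ⟨ν, hν⟩
        conv at this => lhs; arg 2; rw [← Lp.toLp_coeFn h (Lp.memLp h)]
        rwa [inner_toLp_eq_integral_mul] at this)
      rw [Lp.eq_zero_iff_ae_eq_zero]
      have h2 := hK h (Lp.memLp h)
      rw [Lp.toLp_coeFn] at h2
      filter_upwards [h1, h2] with z h3 h4
      rw [h4, h3]; rfl
    · refine hsum.congr fun i => ?_
      rw [inner_toLp_eq_integral_mul]
  obtain ⟨h, hh⟩ := hex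
  refine ⟨h, Lp.memLp h, ?_⟩
  have h1 := hK h (Lp.memLp h)
  rw [Lp.toLp_coeFn, hh] at h1
  filter_upwards [h1, hb.coeFn_toLp] with z h2 h3
  rw [← h2, h3]

/-- Landweber iteration with functions in place of their classes in `L²`. The recursion involves
kernel integrals only, so that the iterates depend measurably on parameters. -/
lemma exists_tendsto_landweber_kernel {𝒲 𝒵 : Type*}
    [MeasurableSpace 𝒲] [MeasurableSpace 𝒵]
    {m𝒲 : Measure 𝒲} [IsProbabilityMeasure m𝒲] {m𝒵 : Measure 𝒵} [IsProbabilityMeasure m𝒵]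
    {κ : Kernel 𝒵 𝒲} [IsMarkovKernel κ] {κ' : Kernel 𝒲 𝒵} [IsMarkovKernel κ']
    (hjoint : (m𝒵 ⊗ₘ κ).map Prod.swap = m𝒲 ⊗ₘ κ')
    {b : 𝒵 → ℝ} {h₀ : 𝒲 → ℝ} (hh₀ : MemLp h₀ 2 m𝒲) (hb : ∀ᵐ z ∂m𝒵, ∫ w, h₀ w ∂(κ z) = b z)
    (h : ℕ → 𝒲 → ℝ) (hzero : h 0 = 0)
    (hsucc : ∀ n w, h (n + 1) w = h n w + ∫ z, (b z - ∫ w', h n w' ∂(κ z)) ∂(κ' w)) :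
    (∀ n, MemLp (h n) 2 m𝒲) ∧ ∃ l : 𝒲 → ℝ, MemLp l 2 m𝒲 ∧
      (∀ᵐ z ∂m𝒵, ∫ w, l w ∂(κ z) = b z) ∧
      Tendsto (fun n => eLpNorm (h n - l) 2 m𝒲) atTop (𝓝 0) := by
  obtain ⟨K, K', hK, hK', hadj, hle⟩ := exists_adjoint_kernelOperators hjoint
  have hm' : κ ∘ₘ m𝒵 = m𝒲 := by
    rw [← Measure.snd_compProd, ← Measure.fst_map_swap, hjoint, Measure.fst_compProd]
  have hm : κ' ∘ₘ m𝒲 = m𝒵 := by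
    rw [← Measure.snd_compProd, ← hjoint, Measure.snd_map_swap, Measure.fst_compProd]
  have hKmem : ∀ {f : 𝒲 → ℝ}, MemLp f 2 m𝒲 → MemLp (fun z => ∫ w, f w ∂(κ z)) 2 m𝒵 := by
    intro f hf
    exact (memLp_integral_kernel (hm'.symm ▸ hf)).1
  have hbmem : MemLp b 2 m𝒵 := (memLp_congr_ae hb).mp (hKmem hh₀)
  have hres : ∀ {f : 𝒲 → ℝ}, MemLp f 2 m𝒲 → MemLp (fun z => b z - ∫ w, f w ∂(κ z)) 2 m𝒵 :=
    fun hf => hbmem.sub (hKmem hf)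
  have hmem : ∀ n, MemLp (h n) 2 m𝒲 := by
    intro n
    induction n with
    | zero => rw [hzero]; exact MemLp.zero
    | succ n ih =>
      have h1 : h (n + 1) = h n + fun w => ∫ z, (b z - ∫ w', h n w' ∂(κ z)) ∂(κ' w) :=
        funext fun w => hsucc n w
      rw [h1]
      exact ih.add (memLp_integral_kernel (hm.symm ▸ hres ih)).1
  refine ⟨hmem, ?_⟩
  have hex : ∃ l, Tendsto (fun n => (hmem n).toLp (h n)) atTop (𝓝 l) ∧ K l = hbmem.toLp b := by
    refine exists_tendsto_landweber K K' hadj hle (hbmem.toLp b) (hh₀.toLp h₀) ?_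
      (fun n => (hmem n).toLp (h n)) ?_
    · refine Lp.ext ((hK _ _).trans ?_)
      filter_upwards [hb, hbmem.coeFn_toLp] with z h2 h3
      rw [h2, h3]
    · intro n
      have h1 : hbmem.toLp b - K ((hmem n).toLp (h n)) = (hres (hmem n)).toLp _ := by
        refine Lp.ext ?_
        filter_upwards [Lp.coeFn_sub (hbmem.toLp b) (K ((hmem n).toLp (h n))), hbmem.coeFn_toLp,
          hK _ (hmem n), (hres (hmem n)).coeFn_toLp] with z h1 h2 h3 h4
        rw [h1, h4, Pi.sub_apply, h2, h3]
      rw [h1]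
      refine Lp.ext ?_
      filter_upwards [Lp.coeFn_add ((hmem n).toLp (h n)) (K' ((hres (hmem n)).toLp _)),
        (hmem n).coeFn_toLp, (hmem (n + 1)).coeFn_toLp, hK' _ (hres (hmem n))] with w h1 h2 h3 h4
      rw [h1, h3, Pi.add_apply, h2, h4, hsucc]
  obtain ⟨l, hl, hKl⟩ := hex
  refine ⟨l, Lp.memLp l, ?_, ?_⟩
  · have h1 := hK l (Lp.memLp l)
    rw [Lp.toLp_coeFn, hKl] at h1
    filter_upwards [h1, hbmem.coeFn_toLp] with z h2 h3
    rw [← h2, h3]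
  · rw [← Lp.toLp_coeFn l (Lp.memLp l)] at hl
    exact (Lp.tendsto_Lp_iff_tendsto_eLpNorm'' h hmem l (Lp.memLp l)).mp hl

/-! ### Measurable dependence on parameters -/

/-- Chain rule for regular conditional distributions: the law of `(Z, W)` given `X = x` is composed
of the law of `Z` given `X = x` and the law of `W` given `Z` and `X = x`. -/
lemma condDistrib_prodMk_ae_eq {Ω 𝒳 𝒲 𝒵 : Type*} [MeasurableSpace Ω] [MeasurableSpace 𝒳]
    [MeasurableSpace 𝒲] [StandardBorelSpace 𝒲] [Nonempty 𝒲]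
    [MeasurableSpace 𝒵] [StandardBorelSpace 𝒵] [Nonempty 𝒵]
    {μ : Measure Ω} [IsProbabilityMeasure μ] {X : Ω → 𝒳} {W : Ω → 𝒲} {Z : Ω → 𝒵}
    (hX : Measurable X) (hW : Measurable W) (hZ : Measurable Z) :
    ∀ᵐ x ∂(μ.map X), condDistrib (fun ω => (Z ω, W ω)) X μ x =
      condDistrib Z X μ x ⊗ₘ
        (condDistrib W (fun ω => (Z ω, X ω)) μ).comap (fun z => (z, x)) (by fun_prop) := by
  set η : Kernel (𝒳 × 𝒵) 𝒲 := (condDistrib W (fun ω => (Z ω, X ω)) μ).comap Prod.swap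
    measurable_swap with hη
  have h2 : μ.map (fun ω => ((X ω, Z ω), W ω)) = μ.map (fun ω => (X ω, Z ω)) ⊗ₘ η := by
    have h3 : HasCondDistrib W (fun ω => (Z ω, X ω)) (condDistrib W (fun ω => (Z ω, X ω)) μ) μ :=
      ⟨by fun_prop, (compProd_map_condDistrib hW.aemeasurable).symm⟩
    exact (h3.measurableEquiv_comp_right MeasurableEquiv.prodComm).map_eq
  have h1 : μ.map (fun ω => (X ω, (Z ω, W ω))) = μ.map X ⊗ₘ (condDistrib Z X μ ⊗ₖ η) := by
    have h4 : μ.map (fun ω => ((X ω, Z ω), W ω)) = (μ.map X ⊗ₘ condDistrib Z X μ) ⊗ₘ η := by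
      rw [h2, compProd_map_condDistrib hZ.aemeasurable]
    have h5 : μ.map (fun ω => (X ω, (Z ω, W ω))) =
        (μ.map (fun ω => ((X ω, Z ω), W ω))).map MeasurableEquiv.prodAssoc := by
      rw [Measure.map_map (by fun_prop) (by fun_prop)]; rfl
    rw [h5, h4]
    exact Measure.compProd_assoc'
  filter_upwards [condDistrib_ae_eq_of_measure_eq_compProd X (by fun_prop) h1] with x hx
  rw [hx, Kernel.compProd_apply_eq_compProd_sectR]
  rfl

/-- For almost every `x`, the conditional laws of `W` given `(Z, x)` and of `Z` given `(W, x)` come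
from the same joint law. -/
lemma condDistrib_compProd_swap_eq {Ω 𝒳 𝒲 𝒵 : Type*} [MeasurableSpace Ω] [MeasurableSpace 𝒳]
    [MeasurableSpace 𝒲] [StandardBorelSpace 𝒲] [Nonempty 𝒲]
    [MeasurableSpace 𝒵] [StandardBorelSpace 𝒵] [Nonempty 𝒵]
    {μ : Measure Ω} [IsProbabilityMeasure μ] {X : Ω → 𝒳} {W : Ω → 𝒲} {Z : Ω → 𝒵}
    (hX : Measurable X) (hW : Measurable W) (hZ : Measurable Z) :
    ∀ᵐ x ∂(μ.map X),
      (condDistrib Z X μ x ⊗ₘ (condDistrib W (fun ω => (Z ω, X ω)) μ).comap (fun z => (z, x))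
        (by fun_prop)).map Prod.swap =
      condDistrib W X μ x ⊗ₘ (condDistrib Z (fun ω => (W ω, X ω)) μ).comap (fun w => (w, x))
        (by fun_prop) := by
  filter_upwards [condDistrib_prodMk_ae_eq hX hW hZ, condDistrib_prodMk_ae_eq hX hZ hW,
    condDistrib_comp X (hZ.prodMk hW).aemeasurable (μ := μ) (f := Prod.swap) measurable_swap]
    with x h1 h2 h3
  rw [← h1, ← h2, ← Kernel.map_apply _ measurable_swap, ← h3]
  rfl

lemma measurable_eLpNorm_kernel {α β : Type*} [MeasurableSpace α] [MeasurableSpace β]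
    (κ : Kernel α β) [IsSFiniteKernel κ] {f : β × α → ℝ} (hf : Measurable f) :
    Measurable fun x => eLpNorm (fun w => f (w, x)) 2 (κ x) := by
  simp_rw [eLpNorm_eq_lintegral_rpow_enorm_toReal (p := (2 : ℝ≥0∞)) (by norm_num) (by norm_num)]
  refine Measurable.pow_const ?_ _
  refine Measurable.lintegral_kernel_prod_right (f := fun x w => ‖f (w, x)‖ₑ ^ (2 : ℝ≥0∞).toReal) ?_
  exact ((hf.comp measurable_swap).enorm).pow_const _

/-- The least index with a measurable property, as a measurable function. -/
lemma exists_measurable_least {α : Type*} [MeasurableSpace α] (P : α → ℕ → Prop)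
    (hP : ∀ N, MeasurableSet {x | P x N}) :
    ∃ ν : α → ℕ, Measurable ν ∧ ∀ x N, P x N → P x (ν x) ∧ ν x ≤ N := by
  classical
  have hex : ∀ x, ∃ N, P x N ∨ ¬ ∃ N', P x N' := by
    intro x
    by_cases h : ∃ N', P x N'
    · obtain ⟨N, hN⟩ := h; exact ⟨N, Or.inl hN⟩
    · exact ⟨0, Or.inr h⟩
  refine ⟨fun x => Nat.find (hex x), measurable_find hex fun N => ?_, fun x N hN => ?_⟩
  · have hset : {x | P x N ∨ ¬ ∃ N', P x N'} = {x | P x N} ∪ (⋃ N', {x | P x N'})ᶜ := by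
      ext x; simp
    rw [hset]
    exact (hP N).union (MeasurableSet.iUnion fun N' => hP N').compl
  · refine ⟨?_, Nat.find_min' (hex x) (Or.inl hN)⟩
    rcases Nat.find_spec (hex x) with h | h
    · exact h
    · exact absurd ⟨N, hN⟩ h

/-- Functions `f n (·, x)` that converge in `L²` for each parameter `x` have a limit that is jointly
measurable in the argument and the parameter. The index of a rapidly converging subsequence is
chosen as the least one that works, which depends measurably on `x`. -/
lemma exists_measurable_ae_eq_of_tendsto_eLpNorm {α β : Type*} [MeasurableSpace α]
    [MeasurableSpace β] (κ : Kernel α β) [IsMarkovKernel κ] (f : ℕ → β × α → ℝ)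
    (hf : ∀ n, Measurable (f n)) :
    ∃ q : β × α → ℝ, Measurable q ∧ ∀ x, ∀ l : β → ℝ, MemLp l 2 (κ x) →
      Tendsto (fun n => eLpNorm ((fun w => f n (w, x)) - l) 2 (κ x)) atTop (𝓝 0) →
      (fun w => q (w, x)) =ᵐ[κ x] l := by
  classical
  let P : ℕ → α → ℕ → Prop := fun k x N => k ≤ N ∧ ∀ i j, N ≤ i → N ≤ j →
    eLpNorm (fun w => f i (w, x) - f j (w, x)) 2 (κ x) < (2⁻¹ : ℝ≥0∞) ^ k
  have hPmeas : ∀ k N, MeasurableSet {x | P k x N} := by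
    intro k N
    have hset : {x | P k x N} = {_x | k ≤ N} ∩ ⋂ i, ⋂ j, ⋂ (_ : N ≤ i), ⋂ (_ : N ≤ j),
        {x | eLpNorm (fun w => f i (w, x) - f j (w, x)) 2 (κ x) < (2⁻¹ : ℝ≥0∞) ^ k} := by
      ext x; simp [P]
    rw [hset]
    refine MeasurableSet.inter (MeasurableSet.const _) ?_
    refine MeasurableSet.iInter fun i => MeasurableSet.iInter fun j => MeasurableSet.iInter fun _ =>
      MeasurableSet.iInter fun _ => ?_
    have hm : Measurable fun x => eLpNorm (fun w => f i (w, x) - f j (w, x)) 2 (κ x) :=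
      measurable_eLpNorm_kernel κ (f := fun p => f i p - f j p) ((hf i).sub (hf j))
    exact hm measurableSet_Iio
  choose ν hνmeas hν using fun k => exists_measurable_least (P k) (hPmeas k)
  obtain ⟨F, hF⟩ : ∃ F : ℕ → β × α → ℝ, ∀ k p, F k p = f (ν k p.2) p := ⟨_, fun _ _ => rfl⟩
  have hFmeas : ∀ k, Measurable (F k) := by
    intro k
    have h1 : Measurable (fun y : ℕ × (β × α) => f y.1 y.2) :=
      measurable_from_prod_countable_right fun n => hf n
    have h2 := h1.comp (((hνmeas k).comp measurable_snd).prodMk measurable_id)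
    rwa [show F k = _ from funext fun p => hF k p]
  refine ⟨fun p => limsup (fun k => F k p) atTop, Measurable.limsup hFmeas, ?_⟩
  intro x l hl hlim
  have hsec : ∀ n, AEStronglyMeasurable (fun w => f n (w, x)) (κ x) := fun n =>
    ((hf n).comp (by fun_prop : Measurable fun w => (w, x))).aestronglyMeasurable
  have hPex : ∀ k, ∃ N, P k x N := by
    intro k
    have hpos : (0 : ℝ≥0∞) < (2⁻¹ : ℝ≥0∞) ^ k / 2 :=
      ENNReal.half_pos (pow_ne_zero _ (by simp))
    obtain ⟨N, hN⟩ := eventually_atTop.mp (hlim.eventually_lt_const hpos)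
    refine ⟨max k N, le_max_left _ _, fun i j hi hj => ?_⟩
    have h1 : (fun w => f i (w, x) - f j (w, x)) =
        ((fun w => f i (w, x)) - l) - ((fun w => f j (w, x)) - l) := by
      ext w; simp
    rw [h1]
    calc _ ≤ eLpNorm ((fun w => f i (w, x)) - l) 2 (κ x) +
          eLpNorm ((fun w => f j (w, x)) - l) 2 (κ x) :=
          eLpNorm_sub_le ((hsec i).sub hl.1) ((hsec j).sub hl.1) (by norm_num)
      _ < (2⁻¹ : ℝ≥0∞) ^ k / 2 + (2⁻¹ : ℝ≥0∞) ^ k / 2 :=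
          ENNReal.add_lt_add (hN i ((le_max_right _ _).trans hi))
            (hN j ((le_max_right _ _).trans hj))
      _ = _ := ENNReal.add_halves _
  have hνP : ∀ k, P k x (ν k x) := fun k => by
    obtain ⟨N, hN⟩ := hPex k
    exact (hν k x N hN).1
  have hνmono : Monotone fun k => ν k x := by
    refine monotone_nat_of_le_succ fun k => ?_
    refine (hν k x _ ?_).2
    obtain ⟨h1, h2⟩ := hνP (k + 1)
    refine ⟨by omega, fun i j hi hj => (h2 i j hi hj).trans_le ?_⟩
    exact pow_le_pow_of_le_one (by simp) (by simp) (Nat.le_succ k)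
  have hνtop : Tendsto (fun k => ν k x) atTop atTop :=
    tendsto_atTop_mono (fun k => (hνP k).1) tendsto_id
  have hFx : ∀ k, (fun w => F k (w, x)) = fun w => f (ν k x) (w, x) := fun k =>
    funext fun w => hF k (w, x)
  have hsecF : ∀ k, AEStronglyMeasurable (fun w => F k (w, x)) (κ x) := fun k => by
    rw [hFx]; exact hsec _
  -- The subsequence is rapidly Cauchy, so that it converges almost everywhere.
  have hae : ∀ᵐ w ∂(κ x), ∃ c : ℝ, Tendsto (fun k => F k (w, x)) atTop (𝓝 c) := by
    refine Lp.ae_tendsto_of_cauchy_eLpNorm (f := fun k w => F k (w, x)) (p := 2)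
      (B := fun k => (2⁻¹ : ℝ≥0∞) ^ k) hsecF (by norm_num) ?_ ?_
    · rw [ENNReal.tsum_geometric]; simp
    · intro N n m hn hm
      simp only [hFx]
      exact (hνP N).2 _ _ (hνmono hn) (hνmono hm)
  have hlimF : Tendsto (fun k => eLpNorm ((fun w => F k (w, x)) - l) 2 (κ x)) atTop (𝓝 0) := by
    simp only [hFx]
    exact hlim.comp hνtop
  have hmeasure : TendstoInMeasure (κ x) (fun k w => F k (w, x)) atTop l :=
    tendstoInMeasure_of_tendsto_eLpNorm (p := 2) (by norm_num) hsecF hl.1 hlimF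
  obtain ⟨ns, hns, hsub⟩ := hmeasure.exists_seq_tendsto_ae
  filter_upwards [hae, hsub] with w h1 h2
  obtain ⟨c, hc⟩ := h1
  rw [hc.limsup_eq]
  exact tendsto_nhds_unique (hc.comp hns.tendsto_atTop) h2

/-- If for almost every `x` the equation `E[h(W) | Z = ·, X = x] = b(·, x)` has a solution in `L²`,
then there are solutions that depend measurably on `x`: the limits of the Landweber iterates. -/
lemma exists_measurable_solution {Ω 𝒳 𝒲 𝒵 : Type*} [MeasurableSpace Ω] [MeasurableSpace 𝒳]
    [MeasurableSpace 𝒲] [StandardBorelSpace 𝒲] [Nonempty 𝒲]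
    [MeasurableSpace 𝒵] [StandardBorelSpace 𝒵] [Nonempty 𝒵]
    {μ : Measure Ω} [IsProbabilityMeasure μ] {X : Ω → 𝒳} {W : Ω → 𝒲} {Z : Ω → 𝒵}
    (hX : Measurable X) (hW : Measurable W) (hZ : Measurable Z)
    {b : 𝒵 × 𝒳 → ℝ} (hb : Measurable b)
    (hsol : ∀ᵐ x ∂(μ.map X), ∃ h : 𝒲 → ℝ, MemLp h 2 (condDistrib W X μ x) ∧
      ∀ᵐ z ∂(condDistrib Z X μ x),
        ∫ w, h w ∂(condDistrib W (fun ω => (Z ω, X ω)) μ (z, x)) = b (z, x)) :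
    ∃ q : 𝒲 × 𝒳 → ℝ, Measurable q ∧ ∀ᵐ x ∂(μ.map X),
      MemLp (fun w => q (w, x)) 2 (condDistrib W X μ x) ∧
      ∀ᵐ z ∂(condDistrib Z X μ x),
        ∫ w, q (w, x) ∂(condDistrib W (fun ω => (Z ω, X ω)) μ (z, x)) = b (z, x) := by
  set κ := condDistrib W (fun ω => (Z ω, X ω)) μ with hκ
  set κ' := condDistrib Z (fun ω => (W ω, X ω)) μ with hκ'
  let h : ℕ → 𝒲 × 𝒳 → ℝ := fun n => Nat.rec (fun _ => 0) (fun _ f p =>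
    f p + ∫ z, (b (z, p.2) - ∫ w', f (w', p.2) ∂(κ (z, p.2))) ∂(κ' p)) n
  have hsucc : ∀ n p, h (n + 1) p = h n p +
      ∫ z, (b (z, p.2) - ∫ w', h n (w', p.2) ∂(κ (z, p.2))) ∂(κ' p) := fun n p => rfl
  have hmeas : ∀ n, Measurable (h n) := by
    intro n
    induction n with
    | zero => exact measurable_const
    | succ n ih =>
      have h1 : Measurable fun y : 𝒵 × 𝒳 => ∫ w', h n (w', y.2) ∂(κ y) := by
        refine StronglyMeasurable.measurable ?_
        refine StronglyMeasurable.integral_kernel_prod_right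
          (f := fun (y : 𝒵 × 𝒳) w' => h n (w', y.2)) ?_
        exact (ih.comp
          (by fun_prop : Measurable fun y : (𝒵 × 𝒳) × 𝒲 => (y.2, y.1.2))).stronglyMeasurable
      have h2 : Measurable fun p : 𝒲 × 𝒳 =>
          ∫ z, (b (z, p.2) - ∫ w', h n (w', p.2) ∂(κ (z, p.2))) ∂(κ' p) := by
        refine StronglyMeasurable.measurable ?_
        refine StronglyMeasurable.integral_kernel_prod_right
          (f := fun (p : 𝒲 × 𝒳) z => b (z, p.2) - ∫ w', h n (w', p.2) ∂(κ (z, p.2))) ?_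
        exact ((hb.sub h1).comp
          (by fun_prop : Measurable fun y : (𝒲 × 𝒳) × 𝒵 => (y.2, y.1.2))).stronglyMeasurable
      exact ih.add h2
  obtain ⟨q, hq, hlim⟩ := exists_measurable_ae_eq_of_tendsto_eLpNorm (condDistrib W X μ) h hmeas
  refine ⟨q, hq, ?_⟩
  filter_upwards [hsol, condDistrib_compProd_swap_eq hX hW hZ] with x ⟨h₀, hh₀, hh₀b⟩ hjoint
  obtain ⟨-, l, hl, hKl, hten⟩ := exists_tendsto_landweber_kernel hjoint (b := fun z => b (z, x))
    hh₀ hh₀b (fun n w => h n (w, x)) rfl (fun n w => hsucc n (w, x))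
  have hql := hlim x l hl hten
  refine ⟨(memLp_congr_ae hql).mpr hl, ?_⟩
  have hm' : κ.comap (fun z => (z, x)) (by fun_prop) ∘ₘ condDistrib Z X μ x =
      condDistrib W X μ x := by
    rw [← Measure.snd_compProd, ← Measure.fst_map_swap, hjoint, Measure.fst_compProd]
  rw [← hm'] at hql
  filter_upwards [hKl, Measure.ae_ae_of_ae_comp hql] with z h1 h2
  rw [← h1]
  exact integral_congr_ae h2

/-! ### Conditional distributions -/

section CondDistrib

variable {Ω 𝒳 𝒴 : Type*} [MeasurableSpace Ω] [MeasurableSpace 𝒳]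
  [MeasurableSpace 𝒴] [StandardBorelSpace 𝒴] [Nonempty 𝒴]
  {μ : Measure Ω} [IsProbabilityMeasure μ] {X : Ω → 𝒳} {Y : Ω → 𝒴}

lemma ae_ae_condDistrib_of_ae_map (hY : Measurable Y) {p : 𝒳 × 𝒴 → Prop}
    (h : ∀ᵐ y ∂(μ.map fun ω => (X ω, Y ω)), p y) :
    ∀ᵐ x ∂(μ.map X), ∀ᵐ y ∂(condDistrib Y X μ x), p (x, y) := by
  rw [← compProd_map_condDistrib hY.aemeasurable] at h
  exact Measure.ae_ae_of_ae_compProd h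

lemma ae_map_of_ae_ae_condDistrib (hY : Measurable Y) {p : 𝒳 × 𝒴 → Prop}
    (hp : MeasurableSet {y | p y})
    (h : ∀ᵐ x ∂(μ.map X), ∀ᵐ y ∂(condDistrib Y X μ x), p (x, y)) :
    ∀ᵐ y ∂(μ.map fun ω => (X ω, Y ω)), p y := by
  rw [← compProd_map_condDistrib hY.aemeasurable]
  exact Measure.ae_compProd_of_ae_ae hp h

lemma ae_integrable_condDistrib (hX : Measurable X) (hY : Measurable Y) {f : 𝒳 × 𝒴 → ℝ}
    (hf : Measurable f) (hint : Integrable (fun ω => f (X ω, Y ω)) μ) :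
    ∀ᵐ x ∂(μ.map X), Integrable (fun y => f (x, y)) (condDistrib Y X μ x) := by
  refine Integrable.condDistrib_ae_map hY.aemeasurable ?_
  exact (integrable_map_measure hf.aestronglyMeasurable (hX.prodMk hY).aemeasurable).mpr hint

lemma ae_memLp_condDistrib (hX : Measurable X) (hY : Measurable Y) {f : 𝒳 × 𝒴 → ℝ}
    (hf : Measurable f) (hint : MemLp (fun ω => f (X ω, Y ω)) 2 μ) :
    ∀ᵐ x ∂(μ.map X), MemLp (fun y => f (x, y)) 2 (condDistrib Y X μ x) := by
  have h1 := ae_integrable_condDistrib hX hY (hf.pow_const 2) hint.integrable_sq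
  filter_upwards [h1] with x hx
  refine (memLp_two_iff_integrable_sq ?_).mpr hx
  exact (hf.comp (by fun_prop : Measurable fun y => (x, y))).aestronglyMeasurable

/-- A function that is square-integrable conditionally on almost every value of `X` becomes
square-integrable after multiplication by a positive weight that depends on `X` only. -/
lemma exists_weight_memLp (hX : Measurable X) (hY : Measurable Y) {q : 𝒴 × 𝒳 → ℝ}
    (hq : Measurable q)
    (hmem : ∀ᵐ x ∂(μ.map X), MemLp (fun y => q (y, x)) 2 (condDistrib Y X μ x)) :
    ∃ c : 𝒳 → ℝ, Measurable c ∧ (∀ x, 0 < c x) ∧ (∀ x, c x ≤ 1) ∧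
      MemLp (fun ω => c (X ω) * q (Y ω, X ω)) 2 μ := by
  let N : 𝒳 → ℝ≥0∞ := fun x => eLpNorm (fun y => q (y, x)) 2 (condDistrib Y X μ x)
  have hN : Measurable N := measurable_eLpNorm_kernel _ hq
  let c : 𝒳 → ℝ := fun x => (1 + (N x).toReal)⁻¹
  have hc : Measurable c := (measurable_const.add hN.ennreal_toReal).inv
  have hc0 : ∀ x, 0 < c x := fun x => by positivity
  have hc1 : ∀ x, c x ≤ 1 := fun x => inv_le_one_of_one_le₀ (by simp [ENNReal.toReal_nonneg])
  refine ⟨c, hc, hc0, hc1, ?_⟩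
  have hm : Measurable fun p : 𝒳 × 𝒴 => c p.1 * q (p.2, p.1) :=
    (hc.comp measurable_fst).mul (hq.comp measurable_swap)
  have key : eLpNorm (fun p : 𝒳 × 𝒴 => c p.1 * q (p.2, p.1)) 2
      (μ.map fun ω => (X ω, Y ω)) ≤ 1 := by
    rw [← compProd_map_condDistrib hY.aemeasurable,
      eLpNorm_eq_lintegral_rpow_enorm_toReal (by norm_num) (by norm_num),
      Measure.lintegral_compProd (hm.enorm.pow_const _)]
    refine ENNReal.rpow_le_one ?_ (by norm_num)
    have : IsProbabilityMeasure (μ.map X) := Measure.isProbabilityMeasure_map hX.aemeasurable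
    calc _ ≤ ∫⁻ x, 1 ∂(μ.map X) := ?_
      _ = 1 := by simp
    refine lintegral_mono_ae ?_
    filter_upwards [hmem] with x hx
    have h1 : eLpNorm (fun y => c x * q (y, x)) 2 (condDistrib Y X μ x) ≤ 1 := by
      have h2 : (fun y => c x * q (y, x)) = c x • fun y => q (y, x) := rfl
      rw [h2, eLpNorm_const_smul]
      change ‖c x‖ₑ * N x ≤ 1
      rw [← ENNReal.ofReal_toReal (show N x ≠ ∞ from hx.2.ne), Real.enorm_eq_ofReal (hc0 x).le,
        ← ENNReal.ofReal_mul (hc0 x).le, ENNReal.ofReal_le_one]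
      change (1 + (N x).toReal)⁻¹ * (N x).toReal ≤ 1
      have : 0 ≤ (N x).toReal := ENNReal.toReal_nonneg
      rw [inv_mul_le_iff₀ (by positivity)]; linarith
    rw [eLpNorm_eq_lintegral_rpow_enorm_toReal (by norm_num) (by norm_num)] at h1
    by_contra hcon
    rw [not_le] at hcon
    exact absurd h1 (not_le.mpr (ENNReal.one_lt_rpow hcon (by norm_num)))
  have h3 : MemLp (fun p : 𝒳 × 𝒴 => c p.1 * q (p.2, p.1)) 2 (μ.map fun ω => (X ω, Y ω)) :=
    ⟨hm.aestronglyMeasurable, key.trans_lt (by simp)⟩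
  exact h3.comp_of_map (hX.prodMk hY).aemeasurable

/-- If `Z` and `Y` are conditionally independent given `X`, then conditioning a function of
`(X, Y)` on `(X, Z)` amounts to conditioning it on `X`. -/
lemma condExp_prodMk_eq_of_condIndepFun [StandardBorelSpace Ω] {𝒵 : Type*} [MeasurableSpace 𝒵]
    [StandardBorelSpace 𝒵] [Nonempty 𝒵] {Z : Ω → 𝒵} (hX : Measurable X) (hY : Measurable Y)
    (hZ : Measurable Z) (hind : Z ⟂ᵢ[X, hX; μ] Y) {f : 𝒳 × 𝒴 → ℝ} (hf : Measurable f)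
    (hint : Integrable (fun ω => f (X ω, Y ω)) μ) :
    μ[fun ω => f (X ω, Y ω) | MeasurableSpace.comap (fun ω => (X ω, Z ω)) inferInstance] =ᵐ[μ]
      fun ω => ∫ y, f (X ω, y) ∂(condDistrib Y X μ (X ω)) := by
  have h1 := (condIndepFun_iff_condDistrib_prod_ae_eq_prodMkRight hY hZ hX).mp hind
  have h2 := condExp_prod_ae_eq_integral_condDistrib (μ := μ) (hX.prodMk hZ) hY.aemeasurable
    (f := fun p : (𝒳 × 𝒵) × 𝒴 => f (p.1.1, p.2))
    (hf.comp (by fun_prop : Measurable fun p : (𝒳 × 𝒵) × 𝒴 => (p.1.1, p.2))).stronglyMeasurable hint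
  refine h2.trans ?_
  filter_upwards [ae_of_ae_map (hX.prodMk hZ).aemeasurable h1] with ω hω
  rw [hω]; rfl

end CondDistrib

/-! ### Solving the integral equations -/

namespace POMDP.ConfoundedPOMDP

variable {Ω : Type*} [MeasurableSpace Ω]
    {μ : Measure Ω} {T : ℕ}
    {𝒮 𝒰 𝒜 𝒲 𝒵 : Type*}
    [MeasurableSpace 𝒮] [MeasurableSpace 𝒰] [MeasurableSpace 𝒲] [MeasurableSpace 𝒵]
    [MeasurableSpace 𝒜]
    (M : POMDP.ConfoundedPOMDP μ T 𝒮 𝒰 𝒜 𝒲 𝒵)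

lemma measurable_sa (t : ℕ) : Measurable (M.sa t) := (M.measurable_S t).prodMk (M.measurable_A t)

lemma measurable_zsa (t : ℕ) : Measurable (M.zsa t) := (M.measurable_Z t).prodMk (M.measurable_sa t)

lemma measurable_ws (t : ℕ) : Measurable (M.ws t) := (M.measurable_W t).prodMk (M.measurable_S t)

variable [IsProbabilityMeasure μ]

lemma memLp_R {t : ℕ} (h1 : 1 ≤ t) (hT : t ≤ T) : MemLp (M.R t) 2 μ :=
  MemLp.of_bound (M.measurable_R t).aestronglyMeasurable 1 (by
    filter_upwards [M.abs_R_le t h1 hT] with ω h using h)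

variable [StandardBorelSpace 𝒮] [Nonempty 𝒮]
    [StandardBorelSpace 𝒲] [Nonempty 𝒲]

lemma measurable_target (t : ℕ) {g : 𝒲 × 𝒮 → ℝ} (hg : Measurable g) :
    Measurable fun y : 𝒵 × (𝒮 × 𝒜) => M.target t g y.1 y.2 := by
  refine StronglyMeasurable.measurable ?_
  refine StronglyMeasurable.integral_kernel_prod_right
    (f := fun (_ : 𝒵 × (𝒮 × 𝒜)) (p : ℝ × (𝒲 × 𝒮)) => p.1 + g p.2)
    (κ := condDistrib (fun ω => (M.R t ω, M.ws (t + 1) ω)) (M.zsa t) μ) ?_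
  have : Measurable fun q : (𝒵 × (𝒮 × 𝒜)) × (ℝ × (𝒲 × 𝒮)) => q.2.1 + g q.2.2 := by fun_prop
  exact this.stronglyMeasurable

variable [StandardBorelSpace 𝒵] [Nonempty 𝒵]

/-- For almost every `(s, a)` the integral equation is solvable in `L²`. -/
lemma ae_exists_memLp_integral_eq_target {G : ℕ → Set (𝒲 × 𝒮 → ℝ)}
    (hCompleteZ : M.CompletenessZ) (hTarget : M.RegularTarget G) (hPicard : M.PicardCondition G)
    {t : ℕ} (h1 : 1 ≤ t) (hT : t ≤ T) {g : 𝒲 × 𝒮 → ℝ} (hg : g ∈ G (t + 1)) :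
    ∀ᵐ x ∂(μ.map (M.sa t)), ∃ h : 𝒲 → ℝ, MemLp h 2 (condDistrib (M.W t) (M.sa t) μ x) ∧
      ∀ᵐ z ∂(condDistrib (M.Z t) (M.sa t) μ x),
        ∫ w, h w ∂(condDistrib (M.W t) (M.zsa t) μ (z, x)) = M.target t g z x := by
  obtain ⟨I, lam, φ, ψ, hS, hsum⟩ := hPicard t h1 hT
  filter_upwards [hS, hsum g hg, hCompleteZ t h1 hT, hTarget t h1 hT g hg,
    condDistrib_compProd_swap_eq (μ := μ) (M.measurable_sa t) (M.measurable_W t) (M.measurable_Z t)]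
    with x hx1 hx2 hx3 hx4 hjoint
  exact POMDP.IsSingularSystem.exists_memLp_integral_eq hjoint hx1
    (fun f hf h0 => (hx3 f hf).mp h0) hx4 hx2

/-- The integral equation has a solution that is jointly measurable in `(w, s, a)`. -/
lemma exists_solvesEquation {G : ℕ → Set (𝒲 × 𝒮 → ℝ)} (hG : M.SquareIntegrableClass G)
    (hCompleteZ : M.CompletenessZ) (hTarget : M.RegularTarget G) (hPicard : M.PicardCondition G)
    {t : ℕ} (h1 : 1 ≤ t) (hT : t ≤ T) {g : 𝒲 × 𝒮 → ℝ} (hg : g ∈ G (t + 1)) :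
    ∃ q, M.SolvesEquation t q g := by
  obtain ⟨hgm, hg2⟩ := hG (t + 1) (by omega) (by omega) g hg
  obtain ⟨q, hq, hsol⟩ := exists_measurable_solution (μ := μ) (M.measurable_sa t)
    (M.measurable_W t) (M.measurable_Z t) (M.measurable_target t hgm)
    (M.ae_exists_memLp_integral_eq_target hCompleteZ hTarget hPicard h1 hT hg)
  have hmem := hsol.mono fun x hx => hx.1
  refine ⟨q, hq, hmem, ?_⟩
  have hqmeas : Measurable fun y : 𝒵 × (𝒮 × 𝒜) =>
      ∫ w, q (w, y.2) ∂(condDistrib (M.W t) (M.zsa t) μ y) := by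
    refine StronglyMeasurable.measurable ?_
    refine StronglyMeasurable.integral_kernel_prod_right
      (f := fun (y : 𝒵 × (𝒮 × 𝒜)) w => q (w, y.2)) ?_
    exact (hq.comp (by fun_prop : Measurable fun y : (𝒵 × (𝒮 × 𝒜)) × 𝒲 =>
      (y.2, y.1.2))).stronglyMeasurable
  have hswap : ∀ᵐ y ∂(μ.map fun ω => (M.sa t ω, M.Z t ω)),
      ∫ w, q (w, y.1) ∂(condDistrib (M.W t) (M.zsa t) μ (y.2, y.1)) = M.target t g y.2 y.1 := by
    refine ae_map_of_ae_ae_condDistrib (M.measurable_Z t) ?_ (hsol.mono fun x hx => hx.2)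
    exact measurableSet_eq_fun (hqmeas.comp measurable_swap)
      ((M.measurable_target t hgm).comp measurable_swap)
  have hsol' : ∀ᵐ y ∂(μ.map (M.zsa t)),
      ∫ w, q (w, y.2) ∂(condDistrib (M.W t) (M.zsa t) μ y) = M.target t g y.1 y.2 := by
    rw [ae_map_iff (M.measurable_zsa t).aemeasurable
      (measurableSet_eq_fun hqmeas (M.measurable_target t hgm))]
    exact ae_of_ae_map ((M.measurable_sa t).prodMk (M.measurable_Z t)).aemeasurable hswap
  -- `q` itself need not be integrable; `c q` is, and `c` drops out of the conditional integrals.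
  obtain ⟨c, hc, hc0, -, hcq⟩ := exists_weight_memLp (M.measurable_sa t) (M.measurable_W t) hq hmem
  have hqint := ae_integrable_condDistrib (μ := μ) (M.measurable_zsa t) (M.measurable_W t)
    (f := fun p => c p.1.2 * q (p.2, p.1.2)) (by fun_prop) (hcq.integrable (by norm_num))
  have hRmeas : Measurable fun ω => (M.R t ω, M.ws (t + 1) ω) :=
    (M.measurable_R t).prodMk (M.measurable_ws (t + 1))
  have hrint := ae_integrable_condDistrib (μ := μ) (M.measurable_zsa t) hRmeas
    (f := fun p => p.2.1 + g p.2.2) (by fun_prop)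
    (((M.memLp_R h1 hT).integrable (by norm_num)).add (hg2.integrable (by norm_num)))
  have hpmeas : Measurable fun ω => (M.W t ω, M.R t ω, M.ws (t + 1) ω) :=
    (M.measurable_W t).prodMk hRmeas
  filter_upwards [hsol', hqint, hrint,
    condDistrib_comp (M.zsa t) (μ := μ) hpmeas.aemeasurable measurable_fst,
    condDistrib_comp (M.zsa t) (μ := μ) hpmeas.aemeasurable measurable_snd]
    with y hy hyq hyr hyW hyR
  set ρ := condDistrib (fun ω => (M.W t ω, M.R t ω, M.ws (t + 1) ω)) (M.zsa t) μ y with hρ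
  rw [Kernel.map_apply _ measurable_fst, ← hρ] at hyW
  rw [Kernel.map_apply _ measurable_snd, ← hρ] at hyR
  have hyW' : condDistrib (M.W t) (M.zsa t) μ y = ρ.map Prod.fst := hyW
  have hyR' : condDistrib (fun ω => (M.R t ω, M.ws (t + 1) ω)) (M.zsa t) μ y = ρ.map Prod.snd := hyR
  have hyq' : Integrable (fun w => q (w, y.2)) (ρ.map Prod.fst) := by
    rw [← hyW']
    exact (integrable_const_mul_iff (hc0 y.2).ne'.isUnit _).mp hyq
  rw [hyR'] at hyr
  have hq1 : Integrable (fun p : 𝒲 × ℝ × (𝒲 × 𝒮) => q (p.1, y.2)) ρ :=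
    hyq'.comp_measurable measurable_fst
  have hr1 : Integrable (fun p : 𝒲 × ℝ × (𝒲 × 𝒮) => p.2.1 + g p.2.2) ρ :=
    hyr.comp_measurable measurable_snd
  have hfun : (fun p : 𝒲 × ℝ × (𝒲 × 𝒮) => q (p.1, y.2.1, y.2.2) - p.2.1 - g p.2.2) =
      fun p => q (p.1, y.2) - (p.2.1 + g p.2.2) := by
    ext p; exact sub_sub _ _ _
  rw [hfun]
  refine ⟨hq1.sub hr1, ?_⟩
  rw [integral_sub hq1 hr1, sub_eq_zero]
  have e1 : ∫ w, q (w, y.2) ∂(ρ.map Prod.fst) = ∫ p, q (p.1, y.2) ∂ρ :=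
    integral_map measurable_fst.aemeasurable hyq'.1
  have e2 : ∫ p, (p.1 + g p.2) ∂(ρ.map Prod.snd) = ∫ p, (p.2.1 + g p.2.2) ∂ρ :=
    integral_map measurable_snd.aemeasurable hyr.1
  rw [← e1, ← e2, ← hyW', ← hyR', hy]
  rfl

/-- Backward recursion. The classes `G t` supply, at each time, a solution whose policy average may
be fed into the equation of the preceding time. -/
lemma exists_solvesRecursion [Fintype 𝒜] {pol : ℕ → Kernel 𝒮 𝒜} {G : ℕ → Set (𝒲 × 𝒮 → ℝ)}
    (hG : M.SquareIntegrableClass G)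
    (hCompleteZ : M.CompletenessZ) (hTarget : M.RegularTarget G) (hPicard : M.PicardCondition G)
    (hBridges : M.ContainsBridges pol G) :
    ∃ q v, M.SolvesRecursion pol q v ∧ ∀ t, 1 ≤ t → t ≤ T → v t ∈ G t := by
  classical
  have hstep : ∀ t g, ∃ q, 1 ≤ t → t ≤ T → g ∈ G (t + 1) →
      M.SolvesEquation t q g ∧ policyAverage (pol t) q ∈ G t := by
    intro t g
    by_cases h : 1 ≤ t ∧ t ≤ T ∧ g ∈ G (t + 1)
    · obtain ⟨q, hq⟩ := hBridges.2 t h.1 h.2.1 g h.2.2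
        (M.exists_solvesEquation hG hCompleteZ hTarget hPicard h.1 h.2.1 h.2.2)
      exact ⟨q, fun _ _ _ => hq⟩
    · exact ⟨0, fun a b c => absurd ⟨a, b, c⟩ h⟩
  choose Q hQ using hstep
  -- `V n` is the bridge at time `T + 1 - n`
  let V : ℕ → 𝒲 × 𝒮 → ℝ := fun n =>
    Nat.rec 0 (fun n g => policyAverage (pol (T - n)) (Q (T - n) g)) n
  have hVsucc : ∀ n, V (n + 1) = policyAverage (pol (T - n)) (Q (T - n) (V n)) := fun n => rfl
  have hVmem : ∀ n, n ≤ T → V n ∈ G (T + 1 - n) := by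
    intro n
    induction n with
    | zero => exact fun _ => hBridges.1
    | succ n ih =>
      intro hn
      have h1 := ih (by omega)
      rw [show T + 1 - n = T - n + 1 by omega] at h1
      rw [hVsucc, Nat.add_sub_add_right]
      exact (hQ (T - n) (V n) (by omega) (by omega) h1).2
  refine ⟨fun t => Q t (V (T - t)), fun t => V (T + 1 - t), ⟨?_, fun t h1 hT => ?_⟩,
    fun t h1 hT => ?_⟩
  · simp only [Nat.sub_self]; rfl
  · have hm := hVmem (T - t) (by omega)
    rw [show T + 1 - (T - t) = t + 1 by omega] at hm
    simp only [Nat.add_sub_add_right]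
    refine ⟨(hQ t _ h1 hT hm).1, ?_⟩
    rw [Nat.sub_add_comm hT, hVsucc, Nat.sub_sub_self hT]
  · have hm := hVmem (T + 1 - t) (by omega)
    rwa [show T + 1 - (T + 1 - t) = t by omega] at hm

end POMDP.ConfoundedPOMDP

/-! ### Trajectories under the target policy -/

namespace POMDP

lemma sum_consStep {𝒮 𝒰 𝒜 : Type*} (n : ℕ)
    (p : ((𝒮 × 𝒰) × 𝒜) × ((ℝ × (𝒮 × 𝒰)) × (Fin n → ((𝒮 × 𝒰) × 𝒜) × ℝ))) :
    ∑ i, (consStep n p i).2 = p.2.1.1 + ∑ i, (p.2.2 i).2 := by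
  rw [Fin.sum_univ_succ]; rfl

lemma ae_iff_forall_pos {α : Type*} [MeasurableSpace α] [Countable α] {ν : Measure α}
    {p : α → Prop} : (∀ᵐ a ∂ν, p a) ↔ ∀ a, 0 < ν {a} → p a := by
  rw [ae_iff_of_countable]
  simp [pos_iff_ne_zero]

section Trajectories

variable {𝒮 𝒰 𝒜 : Type*} [MeasurableSpace 𝒮] [MeasurableSpace 𝒰] [MeasurableSpace 𝒜]

lemma firstStep_apply (n : ℕ) (step : Kernel ((𝒮 × 𝒰) × 𝒜) (ℝ × (𝒮 × 𝒰)))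
    (rest : Kernel (𝒮 × 𝒰) (Fin n → ((𝒮 × 𝒰) × 𝒜) × ℝ)) [IsMarkovKernel step]
    [IsMarkovKernel rest] (x : (𝒮 × 𝒰) × 𝒜) :
    firstStep n step rest x =
      (step x ⊗ₘ rest.comap Prod.snd measurable_snd).map (fun p => consStep n (x, p)) := by
  unfold firstStep
  rw [Kernel.map_apply _ (measurable_consStep n), Kernel.prod_apply, Kernel.id_apply,
    Measure.dirac_prod, Measure.map_map (measurable_consStep n) (by fun_prop),
    Kernel.compProd_apply_eq_compProd_sectR]
  rfl

lemma measurableSet_abs_reward_le (n : ℕ) :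
    MeasurableSet {τ : Fin n → ((𝒮 × 𝒰) × 𝒜) × ℝ | ∀ i, |(τ i).2| ≤ 1} := by
  have : {τ : Fin n → ((𝒮 × 𝒰) × 𝒜) × ℝ | ∀ i, |(τ i).2| ≤ 1} = ⋂ i, {τ | |(τ i).2| ≤ 1} := by
    ext τ; simp
  rw [this]
  exact MeasurableSet.iInter fun i => measurableSet_le (by fun_prop) measurable_const

lemma measurable_sum_reward (n : ℕ) :
    Measurable fun τ : Fin n → ((𝒮 × 𝒰) × 𝒜) × ℝ => ∑ i, (τ i).2 := by fun_prop

lemma integrable_sum_reward {n : ℕ} {ρ : Measure (Fin n → ((𝒮 × 𝒰) × 𝒜) × ℝ)} [IsFiniteMeasure ρ]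
    (h : ∀ᵐ τ ∂ρ, ∀ i, |(τ i).2| ≤ 1) : Integrable (fun τ => ∑ i, (τ i).2) ρ := by
  refine Integrable.of_bound (measurable_sum_reward n).aestronglyMeasurable n ?_
  filter_upwards [h] with τ hτ
  calc ‖∑ i, (τ i).2‖ ≤ ∑ i : Fin n, (1 : ℝ) := norm_sum_le_of_le _ fun i _ => hτ i
    _ = n := by simp

lemma ae_firstStep {n : ℕ} {step : Kernel ((𝒮 × 𝒰) × 𝒜) (ℝ × (𝒮 × 𝒰))}
    {rest : Kernel (𝒮 × 𝒰) (Fin n → ((𝒮 × 𝒰) × 𝒜) × ℝ)} [IsMarkovKernel step]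
    [IsMarkovKernel rest] {x : (𝒮 × 𝒰) × 𝒜}
    (h : ∀ᵐ y ∂(step x), |y.1| ≤ 1 ∧ ∀ᵐ τ ∂(rest y.2), ∀ i, |(τ i).2| ≤ 1) :
    ∀ᵐ τ ∂(firstStep n step rest x), ∀ i, |(τ i).2| ≤ 1 := by
  have hm : Measurable fun p : (ℝ × (𝒮 × 𝒰)) × (Fin n → ((𝒮 × 𝒰) × 𝒜) × ℝ) =>
      consStep n (x, p) := (measurable_consStep n).comp (by fun_prop)
  have hset := measurableSet_abs_reward_le (𝒮 := 𝒮) (𝒰 := 𝒰) (𝒜 := 𝒜) (n + 1)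
  rw [firstStep_apply, ae_map_iff hm.aemeasurable hset]
  refine Measure.ae_compProd_of_ae_ae (hm hset) ?_
  filter_upwards [h] with y ⟨hy1, hy2⟩
  rw [Kernel.comap_apply]
  filter_upwards [hy2] with τ hτ i
  refine Fin.cases ?_ (fun j => ?_) i
  · exact hy1
  · exact hτ j

lemma integral_firstStep {n : ℕ} {step : Kernel ((𝒮 × 𝒰) × 𝒜) (ℝ × (𝒮 × 𝒰))}
    {rest : Kernel (𝒮 × 𝒰) (Fin n → ((𝒮 × 𝒰) × 𝒜) × ℝ)} [IsMarkovKernel step]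
    [IsMarkovKernel rest] {x : (𝒮 × 𝒰) × 𝒜}
    (h : ∀ᵐ y ∂(step x), |y.1| ≤ 1 ∧ ∀ᵐ τ ∂(rest y.2), ∀ i, |(τ i).2| ≤ 1) :
    ∫ τ, ∑ i, (τ i).2 ∂(firstStep n step rest x) =
      ∫ y, (y.1 + ∫ τ, ∑ i, (τ i).2 ∂(rest y.2)) ∂(step x) := by
  have hm : Measurable fun p : (ℝ × (𝒮 × 𝒰)) × (Fin n → ((𝒮 × 𝒰) × 𝒜) × ℝ) =>
      consStep n (x, p) := (measurable_consStep n).comp (by fun_prop)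
  have hint := integrable_sum_reward (ae_firstStep h)
  rw [firstStep_apply] at hint ⊢
  have hint' := hint.comp_measurable hm
  rw [integral_map hm.aemeasurable hint.1]
  refine (Measure.integral_compProd hint').trans ?_
  refine integral_congr_ae ?_
  filter_upwards [h] with y ⟨_, hy⟩
  simp only [Function.comp_apply, sum_consStep, Kernel.comap_apply]
  rw [integral_add (integrable_const _) (integrable_sum_reward hy)]
  simp

lemma stateValue_horizon_succ (step : ℕ → Kernel ((𝒮 × 𝒰) × 𝒜) (ℝ × (𝒮 × 𝒰)))
    (pol : ℕ → Kernel 𝒮 𝒜) (T : ℕ) (x : 𝒮 × 𝒰) : stateValue T step pol (T + 1) x = 0 := by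
  unfold stateValue
  rw [Nat.sub_self]
  simp

variable (step : ℕ → Kernel ((𝒮 × 𝒰) × 𝒜) (ℝ × (𝒮 × 𝒰))) (pol : ℕ → Kernel 𝒮 𝒜)
  [∀ t, IsMarkovKernel (step t)] [∀ t, IsMarkovKernel (pol t)]

lemma id_prod_actKernel_apply (p : Kernel 𝒮 𝒜) [IsMarkovKernel p] (x : 𝒮 × 𝒰) :
    (Kernel.id ×ₖ (actKernel p : Kernel (𝒮 × 𝒰) 𝒜)) x = (p x.1).map (Prod.mk x) := by
  rw [Kernel.prod_apply, Kernel.id_apply, Measure.dirac_prod]; rfl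

lemma measurable_stateValue (T t : ℕ) : Measurable (stateValue T step pol t) := by
  have := isMarkovKernel_trajLaw step pol (T + 1 - t) t
  exact (StronglyMeasurable.integral_kernel
    (measurable_sum_reward _).stronglyMeasurable).measurable

variable [Fintype 𝒜]

lemma ae_trajLaw_succ {n t : ℕ} {x : 𝒮 × 𝒰}
    (h : ∀ a, 0 < pol t x.1 {a} → ∀ᵐ y ∂(step t (x, a)), |y.1| ≤ 1 ∧
      ∀ᵐ τ ∂(trajLaw step pol n (t + 1) y.2), ∀ i, |(τ i).2| ≤ 1) :
    ∀ᵐ τ ∂(trajLaw step pol (n + 1) t x), ∀ i, |(τ i).2| ≤ 1 := by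
  have := isMarkovKernel_trajLaw step pol n (t + 1)
  have hset := measurableSet_abs_reward_le (𝒮 := 𝒮) (𝒰 := 𝒰) (𝒜 := 𝒜) (n + 1)
  rw [trajLaw, Kernel.comp_apply, id_prod_actKernel_apply]
  refine Measure.ae_comp_of_ae_ae hset ?_
  rw [ae_map_iff (by fun_prop) ?_]
  · rw [ae_iff_forall_pos]
    exact fun a ha => ae_firstStep (h a ha)
  · simp only [ae_iff]
    exact Kernel.measurable_coe _ hset.compl (measurableSet_singleton 0)

lemma integral_trajLaw_succ [MeasurableSingletonClass 𝒜] {n t : ℕ} {x : 𝒮 × 𝒰}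
    (h : ∀ a, 0 < pol t x.1 {a} → ∀ᵐ y ∂(step t (x, a)), |y.1| ≤ 1 ∧
      ∀ᵐ τ ∂(trajLaw step pol n (t + 1) y.2), ∀ i, |(τ i).2| ≤ 1) :
    ∫ τ, ∑ i, (τ i).2 ∂(trajLaw step pol (n + 1) t x) =
      ∑ a, (pol t x.1).real {a} *
        ∫ τ, ∑ i, (τ i).2 ∂(firstStep n (step t) (trajLaw step pol n (t + 1)) (x, a)) := by
  have := isMarkovKernel_trajLaw step pol n (t + 1)
  have := isMarkovKernel_trajLaw step pol (n + 1) t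
  have hint := integrable_sum_reward (ae_trajLaw_succ step pol h)
  rw [trajLaw] at hint ⊢
  rw [Kernel.integral_comp hint, id_prod_actKernel_apply, integral_map (by fun_prop)
    (StronglyMeasurable.integral_kernel
      (measurable_sum_reward _).stronglyMeasurable).aestronglyMeasurable,
    integral_fintype (Integrable.of_finite)]
  simp

end Trajectories

/-! ### Values and coverage -/

namespace ConfoundedPOMDP

lemma measurable_policyAverage {𝒮 𝒜 𝒲 : Type*} [MeasurableSpace 𝒮] [MeasurableSpace 𝒜]
    [MeasurableSpace 𝒲] [MeasurableSingletonClass 𝒜] [Fintype 𝒜] (p : Kernel 𝒮 𝒜)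
    {q : 𝒲 × 𝒮 × 𝒜 → ℝ} (hq : Measurable q) :
    Measurable (policyAverage p q) := by
  refine Finset.measurable_sum _ fun a _ => ?_
  refine Measurable.mul ?_ (by fun_prop)
  exact ((Kernel.measurable_coe p (measurableSet_singleton a)).comp measurable_snd).ennreal_toReal

variable {Ω : Type*} [MeasurableSpace Ω]
    {μ : Measure Ω} [IsProbabilityMeasure μ] {T : ℕ}
    {𝒮 𝒰 𝒜 𝒲 𝒵 : Type*}
    [MeasurableSpace 𝒮] [MeasurableSpace 𝒰] [MeasurableSpace 𝒲] [MeasurableSpace 𝒵]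
    [MeasurableSpace 𝒜] (M : POMDP.ConfoundedPOMDP μ T 𝒮 𝒰 𝒜 𝒲 𝒵) {pol : ℕ → Kernel 𝒮 𝒜}

instance (t : ℕ) : IsMarkovKernel (M.step t) := M.step_markov t

/-- The kernel `step t` sends almost every full state and action to bounded rewards and to full
states outside a given null set of the law of `(S_{t+1}, U_{t+1})`. -/
lemma ae_step_of_ae {t : ℕ} (h1 : 1 ≤ t) (hT : t ≤ T) {p : 𝒮 × 𝒰 → Prop}
    (hp : ∀ᵐ x ∂(μ.map (M.su (t + 1))), p x) :
    ∀ᵐ v ∂(μ.map (M.sua t)), ∀ᵐ y ∂(M.step t v), |y.1| ≤ 1 ∧ p y.2 := by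
  have hmeas : Measurable fun ω => (M.sua t ω, (M.R t ω, M.su (t + 1) ω)) :=
    (M.measurable_sua t).prodMk ((M.measurable_R t).prodMk (M.measurable_su (t + 1)))
  refine Measure.ae_ae_of_ae_compProd 
    (p := fun q : ((𝒮 × 𝒰) × 𝒜) × (ℝ × (𝒮 × 𝒰)) => |q.2.1| ≤ 1 ∧ p q.2.2) ?_
  have hlaw : μ.map (fun ω => (M.sua t ω, (M.R t ω, M.su (t + 1) ω))) =
    μ.map (M.sua t) ⊗ₘ M.step t := (M.step_law t h1 hT).map_eq
  rw [← hlaw]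
  refine Filter.Eventually.and ?_ ?_
  · rw [ae_map_iff hmeas.aemeasurable (measurableSet_le (by fun_prop) measurable_const)]
    exact M.abs_R_le t h1 hT
  · have hsnd : (μ.map (fun ω => (M.sua t ω, (M.R t ω, M.su (t + 1) ω)))).map (fun q => q.2.2) =
        μ.map (M.su (t + 1)) := Measure.map_map (by fun_prop) hmeas
    rw [← hsnd] at hp
    exact ae_of_ae_map (by fun_prop) hp

lemma ae_integral_R_eq {t : ℕ} (h1 : 1 ≤ t) (hT : t ≤ T) :
    ∀ᵐ v ∂(μ.map (M.sua t)), Integrable (fun y : ℝ × (𝒮 × 𝒰) => y.1) (M.step t v) ∧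
      ∫ r, r ∂(condDistrib (M.R t) (M.sua t) μ v) = ∫ y, y.1 ∂(M.step t v) := by
  have hfst : condDistrib (M.R t) (M.sua t) μ =ᵐ[μ.map (M.sua t)] (M.step t).fst :=
    condDistrib_ae_eq_of_measure_eq_compProd (M.sua t) (M.measurable_R t).aemeasurable
      (M.step_law t h1 hT).fst.map_eq
  have hbd := M.ae_step_of_ae h1 hT (p := fun _ => True) (Eventually.of_forall fun _ => trivial)
  filter_upwards [hfst, hbd] with v a1 a2
  refine ⟨Integrable.of_bound measurable_fst.aestronglyMeasurable 1 (a2.mono fun y hy => hy.1), ?_⟩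
  rw [a1, Kernel.fst_apply]
  exact integral_map measurable_fst.aemeasurable measurable_id.aestronglyMeasurable

lemma condIndepFun_A_W [StandardBorelSpace Ω] (hReward : M.RewardProxy)
    {t : ℕ} (h1 : 1 ≤ t) (hT : t ≤ T) :
    M.A t ⟂ᵢ[M.su t, M.measurable_su t; μ] M.W t := by
  obtain ⟨hone, hsucc, -⟩ := hReward
  obtain rfl | ht := Nat.eq_or_lt_of_le h1
  · exact (hone hT).symm
  · obtain ⟨k, rfl⟩ : ∃ k, t = k + 1 := ⟨t - 1, by omega⟩
    exact ((hsucc k (by omega) hT).comp measurable_id measurable_fst).symm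

/-- Completeness for the latent state, integrated over `(s, a)`: a square-integrable function of
`((S_t, U_t), A_t)` whose conditional expectation given `(Z_t, S_t, A_t)` vanishes is zero. -/
lemma ae_eq_zero_of_condExp_zsa_eq_zero [StandardBorelSpace 𝒰] [Nonempty 𝒰]
    [StandardBorelSpace 𝒵] [Nonempty 𝒵] (hCompleteU : M.CompletenessU) {t : ℕ} (h1 : 1 ≤ t)
    (hT : t ≤ T) {f : (𝒮 × 𝒰) × 𝒜 → ℝ} (hf : Measurable f)
    (hf2 : MemLp (fun ω => f (M.sua t ω)) 2 μ)
    (h0 : μ[fun ω => f (M.sua t ω) | MeasurableSpace.comap (M.zsa t) inferInstance] =ᵐ[μ] 0) :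
    ∀ᵐ v ∂(μ.map (M.sua t)), f v = 0 := by
  have hU := M.measurable_U t
  have hsa := M.measurable_sa t
  have hzsa := M.measurable_zsa t
  -- `f` as a function of `((s, a), u)`
  have hfx : Measurable fun p : (𝒮 × 𝒜) × 𝒰 => f ((p.1.1, p.2), p.1.2) :=
    hf.comp (by fun_prop)
  have e1 := condExp_prod_ae_eq_integral_condDistrib (μ := μ) hzsa hU.aemeasurable
    (f := fun p : (𝒵 × (𝒮 × 𝒜)) × 𝒰 => f ((p.1.2.1, p.2), p.1.2.2))
    (hf.comp (by fun_prop)).stronglyMeasurable (hf2.integrable (by norm_num))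
  have e2 : ∀ᵐ ω ∂μ, ∫ u, f (((M.zsa t ω).2.1, u), (M.zsa t ω).2.2)
      ∂(condDistrib (M.U t) (M.zsa t) μ (M.zsa t ω)) = 0 := by
    filter_upwards [e1, h0] with ω ha hb
    exact ha.symm.trans hb
  have hmeas : Measurable fun y : 𝒵 × (𝒮 × 𝒜) =>
      ∫ u, f ((y.2.1, u), y.2.2) ∂(condDistrib (M.U t) (M.zsa t) μ y) := by
    refine StronglyMeasurable.measurable ?_
    refine StronglyMeasurable.integral_kernel_prod_right
      (f := fun (y : 𝒵 × (𝒮 × 𝒜)) u => f ((y.2.1, u), y.2.2)) ?_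
    exact (hf.comp (by fun_prop)).stronglyMeasurable
  have e3 : ∀ᵐ y ∂(μ.map fun ω => (M.sa t ω, M.Z t ω)),
      ∫ u, f ((y.1.1, u), y.1.2) ∂(condDistrib (M.U t) (M.zsa t) μ (y.2, y.1)) = 0 := by
    have hset : MeasurableSet {y : (𝒮 × 𝒜) × 𝒵 |
        ∫ u, f ((y.1.1, u), y.1.2) ∂(condDistrib (M.U t) (M.zsa t) μ (y.2, y.1)) = 0} :=
      measurableSet_eq_fun (hmeas.comp measurable_swap) measurable_const
    rw [ae_map_iff (hsa.prodMk (M.measurable_Z t)).aemeasurable hset]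
    exact e2
  have e4 := ae_ae_condDistrib_of_ae_map (X := M.sa t) (M.measurable_Z t) e3
  have e5 := ae_memLp_condDistrib (μ := μ) hsa hU hfx hf2
  have e6 : ∀ᵐ p ∂(μ.map fun ω => (M.sa t ω, M.U t ω)), f ((p.1.1, p.2), p.1.2) = 0 := by
    refine ae_map_of_ae_ae_condDistrib hU (measurableSet_eq_fun hfx measurable_const) ?_
    filter_upwards [e4, e5, hCompleteU t h1 hT] with x hx1 hx2 hx3
    exact (hx3 _ hx2).mp hx1
  rw [ae_map_iff (M.measurable_sua t).aemeasurable (measurableSet_eq_fun hf measurable_const)]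
  exact ae_of_ae_map (hsa.prodMk hU).aemeasurable e6

variable [MeasurableSingletonClass 𝒜] [Fintype 𝒜] [Nonempty 𝒜]

/-- By coverage, a property that holds almost surely under the behaviour policy holds at all actions
that the target policy can take. -/
lemma ae_forall_of_ae_sua (hCov : M.Coverage pol) {t : ℕ} (h1 : 1 ≤ t) (hT : t ≤ T)
    {p : (𝒮 × 𝒰) × 𝒜 → Prop} (hp : ∀ᵐ v ∂(μ.map (M.sua t)), p v) :
    ∀ᵐ x ∂(μ.map (M.su t)), ∀ a, 0 < pol t x.1 {a} → p (x, a) := by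
  filter_upwards [hCov t h1 hT, ae_ae_condDistrib_of_ae_map (X := M.su t) (M.measurable_A t) hp]
    with x hx1 hx2 a ha
  exact ae_iff_forall_pos.mp hx2 a (hx1 a ha)

variable [∀ t, IsMarkovKernel (pol t)]

/-- Rewards are bounded under the target policy, when the trajectory starts at almost every full
state. The bound is known under the behaviour policy only, and is transferred by coverage. -/
lemma ae_abs_reward_le (hCov : M.Coverage pol) (n : ℕ) :
    ∀ t, 1 ≤ t → t + n = T + 1 → ∀ᵐ x ∂(μ.map (M.su t)),
      ∀ᵐ τ ∂(trajLaw M.step pol n t x), ∀ i, |(τ i).2| ≤ 1 := by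
  induction n with
  | zero => exact fun t _ _ => Eventually.of_forall fun x => Eventually.of_forall fun τ i => i.elim0
  | succ n ih =>
    intro t h1 hT
    have h2 := M.ae_step_of_ae h1 (by omega) (ih (t + 1) (by omega) (by omega))
    filter_upwards [M.ae_forall_of_ae_sua hCov h1 (by omega) h2] with x hx
    exact ae_trajLaw_succ M.step pol hx

/-- Bellman equation for the value of a prescribed first action. -/
lemma ae_actionValue_eq (hCov : M.Coverage pol) {t : ℕ} (h1 : 1 ≤ t) (hT : t ≤ T) :
    ∀ᵐ v ∂(μ.map (M.sua t)), actionValue T M.step pol t v =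
      ∫ y, (y.1 + stateValue T M.step pol (t + 1) y.2) ∂(M.step t v) := by
  have := isMarkovKernel_trajLaw M.step pol (T - t) (t + 1)
  filter_upwards [M.ae_step_of_ae h1 hT
    (M.ae_abs_reward_le hCov (T - t) (t + 1) (by omega) (by omega))] with v hv
  unfold actionValue stateValue
  rw [integral_firstStep hv, Nat.add_sub_add_right]

/-- The value of a state is the policy average of the values of the actions. -/
lemma ae_stateValue_eq (hCov : M.Coverage pol) {t : ℕ} (h1 : 1 ≤ t) (hT : t ≤ T) :
    ∀ᵐ x ∂(μ.map (M.su t)), stateValue T M.step pol t x =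
      ∑ a, (pol t x.1).real {a} * actionValue T M.step pol t (x, a) := by
  have h2 := M.ae_step_of_ae h1 hT
    (M.ae_abs_reward_le hCov (T - t) (t + 1) (by omega) (by omega))
  filter_upwards [M.ae_forall_of_ae_sua hCov h1 hT h2] with x hx
  unfold actionValue stateValue
  rw [Nat.sub_add_comm hT]
  exact integral_trajLaw_succ M.step pol hx

/-- Averaging a Q-bridge over the target policy gives a V-bridge: by coverage the Q-bridge identity
holds at every action that the policy can take, and there the law of `W_t` given `(S_t, U_t)` is
also its law given `(S_t, U_t, A_t)`. -/
lemma isVBridge_policyAverage [StandardBorelSpace Ω] [StandardBorelSpace 𝒲] [Nonempty 𝒲]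
    (hReward : M.RewardProxy) (hCov : M.Coverage pol) {t : ℕ}
    (h1 : 1 ≤ t) (hT : t ≤ T) {q : 𝒲 × 𝒮 × 𝒜 → ℝ} (hq : M.IsQBridge pol t q) :
    M.IsVBridge pol t (policyAverage (pol t) q) := by
  refine ⟨measurable_policyAverage (pol t) hq.1, ?_⟩
  have hW := (condIndepFun_iff_condDistrib_prod_ae_eq_prodMkRight (M.measurable_W t)
    (M.measurable_A t) (M.measurable_su t)).mp (M.condIndepFun_A_W hReward h1 hT)
  have hW' : ∀ᵐ v ∂(μ.map (M.sua t)), condDistrib (M.W t) (M.sua t) μ v =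
      condDistrib (M.W t) (M.su t) μ v.1 := hW
  filter_upwards [M.ae_forall_of_ae_sua hCov h1 hT (hq.2.and hW'),
    M.ae_stateValue_eq hCov h1 hT] with x hx hval
  have hterm : ∀ a, Integrable (fun w => (pol t x.1).real {a} * q (w, x.1, a))
      (condDistrib (M.W t) (M.su t) μ x) ∧
      ∫ w, (pol t x.1).real {a} * q (w, x.1, a) ∂(condDistrib (M.W t) (M.su t) μ x) =
        (pol t x.1).real {a} * actionValue T M.step pol t (x, a) := by
    intro a
    rcases eq_zero_or_pos (pol t x.1 {a}) with h0 | hpos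
    · have : (pol t x.1).real {a} = 0 := by simp [measureReal_def, h0]
      simp [this]
    · obtain ⟨⟨hint, heq⟩, hlaw⟩ := hx a hpos
      rw [hlaw] at hint heq
      exact ⟨hint.const_mul _, by rw [integral_const_mul]; rw [heq]⟩
  unfold policyAverage
  refine ⟨integrable_finsetSum _ fun a _ => (hterm a).1, ?_⟩
  rw [integral_finsetSum _ fun a _ => (hterm a).1, hval]
  exact Finset.sum_congr rfl fun a _ => (hterm a).2

end ConfoundedPOMDP

end POMDP

/-! ### From the integral equation to bridges -/

namespace POMDP.ConfoundedPOMDP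

variable {Ω : Type*} [MeasurableSpace Ω] [StandardBorelSpace Ω]
    {μ : Measure Ω} [IsProbabilityMeasure μ] {T : ℕ}
    {𝒮 𝒰 𝒜 𝒲 𝒵 : Type*}
    [MeasurableSpace 𝒮] [StandardBorelSpace 𝒮] [Nonempty 𝒮]
    [MeasurableSpace 𝒰] [StandardBorelSpace 𝒰] [Nonempty 𝒰]
    [MeasurableSpace 𝒲] [StandardBorelSpace 𝒲] [Nonempty 𝒲]
    [MeasurableSpace 𝒵] [MeasurableSpace 𝒜]
    (M : POMDP.ConfoundedPOMDP μ T 𝒮 𝒰 𝒜 𝒲 𝒵)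

section ContinuationValue

variable [MeasurableSingletonClass 𝒜] [Fintype 𝒜] [Nonempty 𝒜]
  {pol : ℕ → Kernel 𝒮 𝒜} [∀ t, IsMarkovKernel (pol t)]

/-- The expectation of a V-bridge at time `t + 1` given `((S_t, U_t), A_t)` is the expected value of
the next full state, as `W_{t+1}` depends on the past through `(S_{t+1}, U_{t+1})` only. -/
lemma ae_integral_ws_eq_of_isVBridge (hReward : M.RewardProxy) {t : ℕ} (h1 : 1 ≤ t)
    (hT : t + 1 ≤ T) {g : 𝒲 × 𝒮 → ℝ} (hg2 : MemLp (fun ω => g (M.ws (t + 1) ω)) 2 μ)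
    (hV : M.IsVBridge pol (t + 1) g) :
    ∀ᵐ v ∂(μ.map (M.sua t)),
      Integrable (fun y => stateValue T M.step pol (t + 1) y.2) (M.step t v) ∧
      ∫ y, g y ∂(condDistrib (M.ws (t + 1)) (M.sua t) μ v) =
        ∫ y, stateValue T M.step pol (t + 1) y.2 ∂(M.step t v) := by
  obtain ⟨hg, hV⟩ := hV
  have hsua := M.measurable_sua t
  have hsu := M.measurable_su (t + 1)
  have hW := M.measurable_W (t + 1)
  have hgint := hg2.integrable (by norm_num)
  have hval := measurable_stateValue M.step pol T (t + 1)
  have hind : M.sua t ⟂ᵢ[M.su (t + 1), hsu; μ] M.W (t + 1) :=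
    ((hReward.2.1 t h1 hT).comp measurable_id measurable_snd).symm
  have e1 := condExp_prodMk_eq_of_condIndepFun (μ := μ) hsu hW hsua hind
    (f := fun p => g (p.2, p.1.1)) (by fun_prop) hgint
  have e2 : μ[fun ω => g (M.ws (t + 1) ω) |
      MeasurableSpace.comap (fun ω => (M.su (t + 1) ω, M.sua t ω)) inferInstance] =ᵐ[μ]
      fun ω => stateValue T M.step pol (t + 1) (M.su (t + 1) ω) := by
    filter_upwards [e1, ae_of_ae_map hsu.aemeasurable hV] with ω a1 a2
    exact a1.trans a2.2
  have hvint : Integrable (fun ω => stateValue T M.step pol (t + 1) (M.su (t + 1) ω)) μ :=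
    integrable_condExp.congr e2
  have hle : MeasurableSpace.comap (M.sua t) inferInstance ≤
      MeasurableSpace.comap (fun ω => (M.su (t + 1) ω, M.sua t ω)) inferInstance := by
    have hcomp : M.sua t = Prod.snd ∘ fun ω => (M.su (t + 1) ω, M.sua t ω) := rfl
    rw [hcomp, ← MeasurableSpace.comap_comp]
    exact MeasurableSpace.comap_mono measurable_snd.comap_le
  have e3 : μ[fun ω => g (M.ws (t + 1) ω) | MeasurableSpace.comap (M.sua t) inferInstance] =ᵐ[μ]
      μ[fun ω => stateValue T M.step pol (t + 1) (M.su (t + 1) ω) |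
        MeasurableSpace.comap (M.sua t) inferInstance] :=
    (condExp_condExp_of_le hle (hsu.prodMk hsua).comap_le).symm.trans (condExp_congr_ae e2)
  have hRsu : Measurable fun ω => (M.R t ω, M.su (t + 1) ω) := (M.measurable_R t).prodMk hsu
  have hstep : condDistrib (fun ω => (M.R t ω, M.su (t + 1) ω)) (M.sua t) μ
      =ᵐ[μ.map (M.sua t)] M.step t :=
    condDistrib_ae_eq_of_measure_eq_compProd (M.sua t) hRsu.aemeasurable
      (M.step_law t h1 (by omega)).map_eq
  have hvaly : Measurable fun y : ℝ × (𝒮 × 𝒰) => stateValue T M.step pol (t + 1) y.2 :=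
    hval.comp measurable_snd
  have e4 := condExp_ae_eq_integral_condDistrib (μ := μ) hsua hRsu.aemeasurable
    hvaly.stronglyMeasurable hvint
  have e5 := condExp_ae_eq_integral_condDistrib (μ := μ) hsua (M.measurable_ws (t + 1)).aemeasurable
    hg.stronglyMeasurable hgint
  have hint := ae_integrable_condDistrib (μ := μ) hsua hRsu (f := fun p =>
    stateValue T M.step pol (t + 1) p.2.2) (hvaly.comp measurable_snd) hvint
  have e6 : ∀ᵐ v ∂(μ.map (M.sua t)), ∫ y, g y ∂(condDistrib (M.ws (t + 1)) (M.sua t) μ v) =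
      ∫ y, stateValue T M.step pol (t + 1) y.2
        ∂(condDistrib (fun ω => (M.R t ω, M.su (t + 1) ω)) (M.sua t) μ v) := by
    rw [ae_map_iff hsua.aemeasurable (measurableSet_eq_fun
      (StronglyMeasurable.integral_kernel hg.stronglyMeasurable).measurable
      (StronglyMeasurable.integral_kernel hvaly.stronglyMeasurable).measurable)]
    filter_upwards [e3, e4, e5] with ω a1 a2 a3
    rw [← a3, a1, a2]
  filter_upwards [hstep, hint, e6] with v a1 a2 a3
  rw [a1] at a2 a3
  exact ⟨a2, a3⟩

end ContinuationValue

variable [StandardBorelSpace 𝒵] [Nonempty 𝒵]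

/-- A solution of the integral equation, in which one conditions on `(Z_t, S_t, A_t)`, satisfies the
same equation conditionally on the latent state, that is on `((S_t, U_t), A_t)`. -/
lemma SolvesEquation.ae_integral_eq {M : POMDP.ConfoundedPOMDP μ T 𝒮 𝒰 𝒜 𝒲 𝒵}
    (hAction : M.ActionProxy) (hCompleteU : M.CompletenessU) {t : ℕ} (h1 : 1 ≤ t)
    (hT : t ≤ T) {q : 𝒲 × 𝒮 × 𝒜 → ℝ} {g : 𝒲 × 𝒮 → ℝ} (hq : M.SolvesEquation t q g)
    (hg : Measurable g) (hg2 : MemLp (fun ω => g (M.ws (t + 1) ω)) 2 μ) :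
    ∀ᵐ v ∂(μ.map (M.sua t)),
      Integrable (fun w => q (w, v.1.1, v.2)) (condDistrib (M.W t) (M.sua t) μ v) ∧
      ∫ w, q (w, v.1.1, v.2) ∂(condDistrib (M.W t) (M.sua t) μ v) =
        ∫ r, r ∂(condDistrib (M.R t) (M.sua t) μ v) +
        ∫ y, g y ∂(condDistrib (M.ws (t + 1)) (M.sua t) μ v) := by
  obtain ⟨hqm, hqmem, hqeq⟩ := hq
  have hsa := M.measurable_sa t
  have hzsa := M.measurable_zsa t
  have hsua := M.measurable_sua t
  have hW := M.measurable_W t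
  have hR := M.measurable_R t
  have hZ := M.measurable_Z t
  have hws := M.measurable_ws (t + 1)
  -- `q` is square-integrable conditionally on `(s, a)` only; the weight `c` repairs this.
  obtain ⟨c, hc, hc0, hc1, hcq⟩ := exists_weight_memLp (μ := μ) hsa hW hqm hqmem
  have hcbd : ∀ {Y : Ω → ℝ}, MemLp Y 2 μ → MemLp (fun ω => c (M.sa t ω) * Y ω) 2 μ := by
    intro Y hY
    refine hY.mono ((hc.comp hsa).aestronglyMeasurable.mul hY.1) (Eventually.of_forall fun ω => ?_)
    rw [norm_mul, Real.norm_of_nonneg (hc0 _).le]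
    exact mul_le_of_le_one_left (norm_nonneg _) (hc1 _)
  have hcR := hcbd (M.memLp_R h1 hT)
  have hcg := hcbd hg2
  -- the three summands as functions of `((s, u), a)` and a further variable
  have hfq : Measurable fun p : ((𝒮 × 𝒰) × 𝒜) × 𝒲 =>
      c (p.1.1.1, p.1.2) * q (p.2, p.1.1.1, p.1.2) := by fun_prop
  have hfR : Measurable fun p : ((𝒮 × 𝒰) × 𝒜) × ℝ => c (p.1.1.1, p.1.2) * p.2 := by fun_prop
  have hfg : Measurable fun p : ((𝒮 × 𝒰) × 𝒜) × (𝒲 × 𝒮) => c (p.1.1.1, p.1.2) * g p.2 := by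
    fun_prop
  obtain ⟨hindW, hindR, hindws⟩ := hAction t h1 hT
  have eW := condExp_prodMk_eq_of_condIndepFun hsua hW hZ hindW hfq (hcq.integrable (by norm_num))
  have eR := condExp_prodMk_eq_of_condIndepFun hsua hR hZ hindR hfR (hcR.integrable (by norm_num))
  have eg := condExp_prodMk_eq_of_condIndepFun hsua hws hZ hindws hfg
    (hcg.integrable (by norm_num))
  let f : (𝒮 × 𝒰) × 𝒜 → ℝ := fun v => c (v.1.1, v.2) *
    (∫ w, q (w, v.1.1, v.2) ∂(condDistrib (M.W t) (M.sua t) μ v) -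
      ∫ r, r ∂(condDistrib (M.R t) (M.sua t) μ v) -
      ∫ y, g y ∂(condDistrib (M.ws (t + 1)) (M.sua t) μ v))
  have hf : Measurable f := by
    have m1 : Measurable fun v : (𝒮 × 𝒰) × 𝒜 =>
        ∫ w, q (w, v.1.1, v.2) ∂(condDistrib (M.W t) (M.sua t) μ v) := by
      refine StronglyMeasurable.measurable ?_
      refine StronglyMeasurable.integral_kernel_prod_right
        (f := fun (v : (𝒮 × 𝒰) × 𝒜) w => q (w, v.1.1, v.2)) ?_
      exact (hqm.comp (by fun_prop)).stronglyMeasurable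
    have m2 : Measurable fun v : (𝒮 × 𝒰) × 𝒜 =>
        ∫ r, r ∂(condDistrib (M.R t) (M.sua t) μ v) :=
      (StronglyMeasurable.integral_kernel measurable_id.stronglyMeasurable).measurable
    have m3 : Measurable fun v : (𝒮 × 𝒰) × 𝒜 =>
        ∫ y, g y ∂(condDistrib (M.ws (t + 1)) (M.sua t) μ v) :=
      (StronglyMeasurable.integral_kernel hg.stronglyMeasurable).measurable
    fun_prop
  -- the residual, weighted
  let F : Ω → ℝ := fun ω =>
    c (M.sa t ω) * q (M.W t ω, M.sa t ω) - c (M.sa t ω) * M.R t ω -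
      c (M.sa t ω) * g (M.ws (t + 1) ω)
  have hF2 : MemLp F 2 μ := (hcq.sub hcR).sub hcg
  have hzsua : Measurable fun ω => (M.sua t ω, M.Z t ω) := hsua.prodMk hZ
  have hFf : μ[F | MeasurableSpace.comap (fun ω => (M.sua t ω, M.Z t ω)) inferInstance]
      =ᵐ[μ] fun ω => f (M.sua t ω) := by
    refine (condExp_sub ((hcq.sub hcR).integrable (by norm_num))
      (hcg.integrable (by norm_num)) _).trans ?_
    have hsub := condExp_sub (hcq.integrable (by norm_num)) (hcR.integrable (by norm_num))
      (MeasurableSpace.comap (fun ω => (M.sua t ω, M.Z t ω)) inferInstance)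
    filter_upwards [hsub, eW, eR, eg] with ω a1 a2 a3 a4
    replace a2 := a2.trans (integral_const_mul _ _)
    replace a3 := a3.trans (integral_const_mul _ _)
    replace a4 := a4.trans (integral_const_mul _ _)
    rw [Pi.sub_apply, a1, Pi.sub_apply]
    simp only [f, mul_sub]
    exact congrArg₂ (· - ·) (congrArg₂ (· - ·) a2 a3) a4
  have hf2 : MemLp (fun ω => f (M.sua t ω)) 2 μ :=
    (memLp_congr_ae hFf).mp (hF2.condExp (by norm_num))
  have hF0 : μ[F | MeasurableSpace.comap (M.zsa t) inferInstance] =ᵐ[μ] 0 := by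
    have hpm : Measurable fun ω => (M.W t ω, M.R t ω, M.ws (t + 1) ω) := hW.prodMk (hR.prodMk hws)
    have e1 := condExp_prod_ae_eq_integral_condDistrib (μ := μ) hzsa hpm.aemeasurable
      (f := fun p : (𝒵 × (𝒮 × 𝒜)) × (𝒲 × ℝ × (𝒲 × 𝒮)) =>
        c p.1.2 * q (p.2.1, p.1.2) - c p.1.2 * p.2.2.1 - c p.1.2 * g p.2.2.2)
      (Measurable.stronglyMeasurable (by fun_prop)) (hF2.integrable (by norm_num))
    filter_upwards [e1, ae_of_ae_map hzsa.aemeasurable hqeq] with ω a1 a2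
    refine a1.trans ?_
    simp only [← mul_sub, integral_const_mul]
    exact mul_eq_zero_of_right _ a2.2
  have hle : MeasurableSpace.comap (M.zsa t) inferInstance ≤
      MeasurableSpace.comap (fun ω => (M.sua t ω, M.Z t ω)) inferInstance := by
    have hcomp : M.zsa t = (fun p : ((𝒮 × 𝒰) × 𝒜) × 𝒵 => (p.2, (p.1.1.1, p.1.2))) ∘
        fun ω => (M.sua t ω, M.Z t ω) := rfl
    rw [hcomp, ← MeasurableSpace.comap_comp]
    exact MeasurableSpace.comap_mono (Measurable.comap_le (by fun_prop))
  have h0 : μ[fun ω => f (M.sua t ω) | MeasurableSpace.comap (M.zsa t) inferInstance]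
      =ᵐ[μ] 0 :=
    (condExp_congr_ae hFf.symm).trans
      ((condExp_condExp_of_le hle hzsua.comap_le).trans hF0)
  have hzero := M.ae_eq_zero_of_condExp_zsa_eq_zero hCompleteU h1 hT hf hf2 h0
  have hint := ae_integrable_condDistrib (μ := μ) hsua hW hfq (hcq.integrable (by norm_num))
  filter_upwards [hzero, hint] with v hv1 hv2
  refine ⟨(integrable_const_mul_iff (hc0 _).ne'.isUnit _).mp hv2, ?_⟩
  have := (mul_eq_zero.mp hv1).resolve_left (hc0 _).ne'
  linarith

variable [MeasurableSingletonClass 𝒜] [Fintype 𝒜] [Nonempty 𝒜]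
  {pol : ℕ → Kernel 𝒮 𝒜} [∀ t, IsMarkovKernel (pol t)]

/-- One step of the backward induction: if `g` is a V-bridge at time `t + 1`, or zero at the
horizon, then solutions of the integral equation with `g` are Q-bridges. -/
lemma isQBridge_of_solvesEquation (hReward : M.RewardProxy) (hAction : M.ActionProxy)
    (hCov : M.Coverage pol) (hCompleteU : M.CompletenessU) {t : ℕ} (h1 : 1 ≤ t) (hT : t ≤ T)
    {q : 𝒲 × 𝒮 × 𝒜 → ℝ} {g : 𝒲 × 𝒮 → ℝ} (hq : M.SolvesEquation t q g)
    (hg2 : MemLp (fun ω => g (M.ws (t + 1) ω)) 2 μ)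
    (hg : (t = T ∧ g = 0) ∨ (t < T ∧ M.IsVBridge pol (t + 1) g)) :
    M.IsQBridge pol t q := by
  have hgm : Measurable g := by
    rcases hg with ⟨-, rfl⟩ | ⟨-, h⟩
    · exact measurable_const
    · exact h.1
  have hcont : ∀ᵐ v ∂(μ.map (M.sua t)),
      Integrable (fun y => stateValue T M.step pol (t + 1) y.2) (M.step t v) ∧
      ∫ y, g y ∂(condDistrib (M.ws (t + 1)) (M.sua t) μ v) =
        ∫ y, stateValue T M.step pol (t + 1) y.2 ∂(M.step t v) := by
    rcases hg with ⟨rfl, rfl⟩ | ⟨h, hV⟩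
    · simp [stateValue_horizon_succ]
    · exact M.ae_integral_ws_eq_of_isVBridge hReward h1 h hg2 hV
  refine ⟨hq.1, ?_⟩
  filter_upwards [hq.ae_integral_eq hAction hCompleteU h1 hT hgm hg2, hcont,
    M.ae_integral_R_eq h1 hT, M.ae_actionValue_eq hCov h1 hT] with v a1 a2 a3 a4
  refine ⟨a1.1, ?_⟩
  rw [a1.2, a2.2, a3.2, a4, integral_add a3.1 a2.1]

/-- Square-integrable solutions of the recursion consist of bridges. -/
lemma SolvesRecursion.isBridge {M : POMDP.ConfoundedPOMDP μ T 𝒮 𝒰 𝒜 𝒲 𝒵}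
    {q : ℕ → 𝒲 × 𝒮 × 𝒜 → ℝ} {v : ℕ → 𝒲 × 𝒮 → ℝ} (hrec : M.SolvesRecursion pol q v)
    (hReward : M.RewardProxy) (hAction : M.ActionProxy)
    (hCov : M.Coverage pol) (hCompleteU : M.CompletenessU)
    (hv : ∀ t, 1 ≤ t → t ≤ T → MemLp (fun ω => v t (M.ws t ω)) 2 μ) {t : ℕ} (h1 : 1 ≤ t)
    (hT : t ≤ T) : M.IsVBridge pol t (v t) ∧ M.IsQBridge pol t (q t) := by
  obtain ⟨hend, hrec⟩ := hrec
  induction hT using Nat.decreasingInduction with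
  | self =>
    have hQ : M.IsQBridge pol T (q T) := by
      refine M.isQBridge_of_solvesEquation hReward hAction hCov hCompleteU h1 le_rfl
        (hrec T h1 le_rfl).1 ?_ (Or.inl ⟨rfl, hend⟩)
      rw [hend]; exact MemLp.zero
    rw [(hrec T h1 le_rfl).2]
    exact ⟨M.isVBridge_policyAverage hReward hCov h1 le_rfl hQ, hQ⟩
  | of_succ k hk ih =>
    have hQ : M.IsQBridge pol k (q k) :=
      M.isQBridge_of_solvesEquation hReward hAction hCov hCompleteU h1 hk.le
        (hrec k h1 hk.le).1 (hv (k + 1) (by omega) hk) (Or.inr ⟨hk, (ih (by omega)).1⟩)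
    rw [(hrec k h1 hk.le).2]
    exact ⟨M.isVBridge_policyAverage hReward hCov h1 hk.le hQ, hQ⟩

end POMDP.ConfoundedPOMDP

theorem theorem4p2 {Ω : Type*} [MeasurableSpace Ω] [StandardBorelSpace Ω]
    {μ : Measure Ω} [IsProbabilityMeasure μ] {T : ℕ}
    {𝒮 𝒰 𝒜 𝒲 𝒵 : Type*}
    [MeasurableSpace 𝒮] [StandardBorelSpace 𝒮] [Nonempty 𝒮]
    [MeasurableSpace 𝒰] [StandardBorelSpace 𝒰] [Nonempty 𝒰]
    [MeasurableSpace 𝒲] [StandardBorelSpace 𝒲] [Nonempty 𝒲]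
    [MeasurableSpace 𝒵] [StandardBorelSpace 𝒵] [Nonempty 𝒵]
    [MeasurableSpace 𝒜] [MeasurableSingletonClass 𝒜] [Fintype 𝒜] [Nonempty 𝒜]
    (M : POMDP.ConfoundedPOMDP μ T 𝒮 𝒰 𝒜 𝒲 𝒵)
    (pol : ℕ → Kernel 𝒮 𝒜) [∀ t, IsMarkovKernel (pol t)]
    (G : ℕ → Set (𝒲 × 𝒮 → ℝ))
    (hMarkov : M.Markovian) (hReward : M.RewardProxy) (hAction : M.ActionProxy)
    (hCoverage : M.Coverage pol)
    (hCompleteU : M.CompletenessU) (hCompleteZ : M.CompletenessZ)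
    (hG : M.SquareIntegrableClass G)
    (hDensities : M.RegularDensities) (hTarget : M.RegularTarget G)
    (hPicard : M.PicardCondition G) (hBridges : M.ContainsBridges pol G) :
    -- the recursion is solvable, and this produces V-bridges and Q-bridges
    (∃ (q : ℕ → 𝒲 × 𝒮 × 𝒜 → ℝ) (v : ℕ → 𝒲 × 𝒮 → ℝ),
      M.SolvesRecursion pol q v ∧
      ∀ t, 1 ≤ t → t ≤ T →
        v t ∈ G t ∧ M.IsVBridge pol t (v t) ∧ M.IsQBridge pol t (q t)) ∧
    -- every (square-integrable) solution of the recursion consists of bridges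
    (∀ (q : ℕ → 𝒲 × 𝒮 × 𝒜 → ℝ) (v : ℕ → 𝒲 × 𝒮 → ℝ),
      M.SolvesRecursion pol q v →
      (∀ t, 1 ≤ t → t ≤ T → MemLp (fun ω => v t (M.ws t ω)) 2 μ) →
      ∀ t, 1 ≤ t → t ≤ T → M.IsVBridge pol t (v t) ∧ M.IsQBridge pol t (q t)) := by
  constructor
  · obtain ⟨q, v, hrec, hv⟩ :=
      M.exists_solvesRecursion hG hCompleteZ hTarget hPicard hBridges
    refine ⟨q, v, hrec, fun t h1 hT => ⟨hv t h1 hT, ?_⟩⟩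
    exact hrec.isBridge hReward hAction hCoverage hCompleteU
      (fun t h1 hT => (hG t h1 (by omega) _ (hv t h1 hT)).2) h1 hT
  · intro q v hrec hv t h1 hT
    exact hrec.isBridge hReward hAction hCoverage hCompleteU hv h1 hT
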